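/- Let $T$ be a coherent theory (a set of coherent sequents over a possibly many-sorted first-order signature) such that the category of $\mathbf{Set}$-models of $T$ and homomorphisms has the amalgamation property: every span $M_1 \leftarrow M_0 \to M_2$ of homomorphisms between $\mathbf{Set}$-models of $T$ can be completed to a commuting square of $\mathbf{Set}$-models of $T$. Let $\mathbf{Set}[T]$ be the classifying topos of $T$, i.e. the topos of sheaves on the syntactic category of $T$ for the coherent topology. A model of $T$ in the topos $\mathbf{Set}^{\mathbb N}$ (respectively $\mathbf{Set}^{\mathbb Z}$), where $\mathbb N$ and $\mathbb Z$ are regarded as one-object categories, is a pair $(M,\sigma)$ of a $\mathbf{Set}$-model $M$ of $T$ and an endomorphism (respectively automorphism) $\sigma$ of $M$. There is a geometric morphism $p : \mathbf{Set}^{\mathbb N} \to \mathbf{Set}[T]$ (respectively $p : \mathbf{Set}^{\mathbb Z} \to \mathbf{Set}[T]$) corresponding to $(M,\sigma)$, i.e. one whose inverse image $p^*$ sends the generic model of $T$ to a model isomorphic to $(M,\sigma)$; and for each such $p$ the following are equivalent: 1. $(M,\sigma)$ is existentially closed (e.c.), that is, $p$ is e.c.: for every geometric morphism $q$ with the same domain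 and codomain as $p$ and every natural transformation $\eta : p^* \Rightarrow q^*$, the naturality square of $\eta$ at every monomorphism of $\mathbf{Set}[T]$ is a pullback; 2. $(M,\sigma)$ is strongly existentially closed (s.e.c.), that is, $p$ is s.e.c.: there are a generating set $\mathcal X$ of objects of $\mathbf{Set}[T]$ and, for each $X \in \mathcal X$, a set $\mathcal B_X$ of subobjects of $X$ such that every subobject of $X$ is a join of members of $\mathcal B_X$, and such that $p^*(A \vee \neg A) = p^*(X)$ for all $X\in\mathcal X$ and $A \in \mathcal B_X$, where $\neg A$ is the pseudo-complement of $A$ among the subobjects of $X$; 3. $M$ is e.c. in $\mathbf{Set}$: every homomorphism $f : M \to N$ to a $\mathbf{Set}$-model $N$ of $T$ reflects satisfaction of all coherent formulas; 4. $M$ is s.e.c. in $\mathbf{Set}$: for every coherent formula $\phi(x)$ and every tuple $a$ of $M$ with $M \not\models \phi(a)$ there is a coherent formula $\psi(x)$ such that $M \models \psi(a)$ and $T$ proves the sequent $\phi(x) \wedge \psi(x) \vdash_x \bot$. -/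

import Mathlib

universe u v₁ v₂ u₁ u₂

open CategoryTheory

namespace CohLogic

/-! ### Many-sorted signatures, coherent formulas, structures -/

/-- Contexts: finite (possibly empty) lists of sorts, built by concatenation. -/
inductive Ctx (S : Type u) : Type u
  | nil : Ctx S
  | single (s : S) : Ctx S
  | append (Γ Δ : Ctx S) : Ctx S

namespace Ctx

variable {S : Type u}

/-- The finite set of variables of a context. -/
def Var : Ctx S → Type
  | nil => Empty
  | single _ => Unit
  | append Γ Δ => Γ.Var ⊕ Δ.Var

/-- The sort of a variable. -/
def sort : (Γ : Ctx S) → Γ.Var → S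
  | nil => fun v => v.elim
  | single s => fun _ => s
  | append Γ Δ => fun v => match v with
    | Sum.inl v => Γ.sort v
    | Sum.inr v => Δ.sort v

end Ctx

/-- A (first-order, many-sorted) signature. Constants are function symbols with `dom f = nil`,
propositional symbols are relation symbols with `arity R = nil`. -/
structure Signature : Type (u + 1) where
  Sorts : Type u
  Fn : Type u
  dom : Fn → Ctx Sorts
  cod : Fn → Sorts
  Rel : Type u
  arity : Rel → Ctx Sorts

/-- Terms in a context. -/
inductive Term (L : Signature.{u}) (Γ : Ctx L.Sorts) : L.Sorts → Type u
  | var (v : Γ.Var) : Term L Γ (Γ.sort v)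
  | app (f : L.Fn) (ts : ∀ v : (L.dom f).Var, Term L Γ ((L.dom f).sort v)) : Term L Γ (L.cod f)

/-- Coherent formulas in a context: built from atomic formulas by finite conjunctions,
finite disjunctions and existential quantification (over a finite tuple of variables). -/
inductive Formula (L : Signature.{u}) : Ctx L.Sorts → Type u
  | top {Γ : Ctx L.Sorts} : Formula L Γ
  | bot {Γ : Ctx L.Sorts} : Formula L Γ
  | eq {Γ : Ctx L.Sorts} {s : L.Sorts} (t t' : Term L Γ s) : Formula L Γ
  | rel {Γ : Ctx L.Sorts} (R : L.Rel) (ts : ∀ v : (L.arity R).Var, Term L Γ ((L.arity R).sort v)) :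
      Formula L Γ
  | and {Γ : Ctx L.Sorts} (φ ψ : Formula L Γ) : Formula L Γ
  | or {Γ : Ctx L.Sorts} (φ ψ : Formula L Γ) : Formula L Γ
  | ex {Γ : Ctx L.Sorts} (Δ : Ctx L.Sorts) (φ : Formula L (Γ.append Δ)) : Formula L Γ

/-- Structures in `Set`; sorts may be empty. -/
structure Str (L : Signature.{u}) : Type (u + 1) where
  carrier : L.Sorts → Type u
  fn (f : L.Fn) : (∀ v : (L.dom f).Var, carrier ((L.dom f).sort v)) → carrier (L.cod f)
  rel (R : L.Rel) : (∀ v : (L.arity R).Var, carrier ((L.arity R).sort v)) → Prop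

section Semantics

variable {L : Signature.{u}}

/-- Tuples of elements of a structure, of the sorts prescribed by a context. -/
abbrev Str.Tuple (M : Str L) (Γ : Ctx L.Sorts) : Type u :=
  ∀ v : Γ.Var, M.carrier (Γ.sort v)

/-- Concatenation of tuples. -/
def Str.pair {M : Str L} {Γ Δ : Ctx L.Sorts} (a : M.Tuple Γ) (b : M.Tuple Δ) :
    M.Tuple (Γ.append Δ)
  | Sum.inl v => a v
  | Sum.inr v => b v

/-- The value of a term at a tuple. -/
def Term.eval {M : Str L} {Γ : Ctx L.Sorts} (a : M.Tuple Γ) :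
    {s : L.Sorts} → Term L Γ s → M.carrier s
  | _, .var v => a v
  | _, .app f ts => M.fn f fun v => (ts v).eval a

/-- Satisfaction `M ⊨ φ(a)`. -/
def Formula.Holds {M : Str L} : {Γ : Ctx L.Sorts} → Formula L Γ → M.Tuple Γ → Prop
  | _, .top, _ => True
  | _, .bot, _ => False
  | _, .eq t t', a => t.eval a = t'.eval a
  | _, .rel R ts, a => M.rel R fun v => (ts v).eval a
  | _, .and φ ψ, a => φ.Holds a ∧ ψ.Holds a
  | _, .or φ ψ, a => φ.Holds a ∨ ψ.Holds a
  | _, .ex _ φ, a => ∃ b, φ.Holds (Str.pair a b)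

/-- Simultaneous substitutions of terms in context `Δ` for the variables of `Γ`. -/
abbrev Subst (L : Signature.{u}) (Γ Δ : Ctx L.Sorts) : Type u :=
  ∀ v : Γ.Var, Term L Δ (Γ.sort v)

def Term.subst {Γ Δ : Ctx L.Sorts} (τ : Subst L Γ Δ) : {s : L.Sorts} → Term L Γ s → Term L Δ s
  | _, .var v => τ v
  | _, .app f ts => .app f fun v => (ts v).subst τ

/-- The projections from a concatenated context, as substitutions. -/
def Subst.left (Γ Δ : Ctx L.Sorts) : Subst L Γ (Γ.append Δ) :=
  fun v => Term.var (Γ := Γ.append Δ) (Sum.inl v)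

def Subst.right (Γ Δ : Ctx L.Sorts) : Subst L Δ (Γ.append Δ) :=
  fun v => Term.var (Γ := Γ.append Δ) (Sum.inr v)

def Subst.comp {Γ Δ Θ : Ctx L.Sorts} (τ : Subst L Γ Δ) (ρ : Subst L Δ Θ) : Subst L Γ Θ :=
  fun v => (τ v).subst ρ

/-- Concatenation of substitutions. -/
def Subst.pair {Γ Δ Θ : Ctx L.Sorts} (τ : Subst L Γ Θ) (ρ : Subst L Δ Θ) :
    Subst L (Γ.append Δ) Θ
  | Sum.inl v => τ v
  | Sum.inr v => ρ v

def Formula.subst : {Γ Δ : Ctx L.Sorts} → Subst L Γ Δ → Formula L Γ → Formula L Δ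
  | _, _, _, .top => .top
  | _, _, _, .bot => .bot
  | _, _, τ, .eq t t' => .eq (t.subst τ) (t'.subst τ)
  | _, _, τ, .rel R ts => .rel R fun v => (ts v).subst τ
  | _, _, τ, .and φ ψ => .and (φ.subst τ) (ψ.subst τ)
  | _, _, τ, .or φ ψ => .or (φ.subst τ) (ψ.subst τ)
  | _, Δ, τ, .ex Θ φ => .ex Θ (φ.subst (Subst.pair (τ.comp (Subst.left Δ Θ)) (Subst.right Δ Θ)))

/-- The conjunction of the equations `t v = t' v`, over all variables `v` of `Γ`. -/
def Formula.eqs : {Γ Δ : Ctx L.Sorts} → Subst L Γ Δ → Subst L Γ Δ → Formula L Δ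
  | .nil, _, _, _ => .top
  | .single _, _, t, t' => .eq (t ()) (t' ())
  | .append _ _, _, t, t' =>
    .and (Formula.eqs (fun v => t (Sum.inl v)) (fun v => t' (Sum.inl v)))
      (Formula.eqs (fun v => t (Sum.inr v)) (fun v => t' (Sum.inr v)))

/-- The value of a substitution at a tuple. -/
def Subst.eval {M : Str L} {Γ Δ : Ctx L.Sorts} (τ : Subst L Γ Δ) (a : M.Tuple Δ) : M.Tuple Γ :=
  fun v => (τ v).eval a

theorem Term.eval_subst {M : Str L} {Γ Δ : Ctx L.Sorts} (τ : Subst L Γ Δ) (a : M.Tuple Δ)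
    {s : L.Sorts} (t : Term L Γ s) : (t.subst τ).eval a = t.eval (τ.eval a) := by
  induction t with
  | var v => rfl
  | app f ts ih => simp only [Term.subst, Term.eval, ih]

theorem Subst.eval_pair {M : Str L} {Γ Δ Θ : Ctx L.Sorts} (τ : Subst L Γ Θ) (ρ : Subst L Δ Θ)
    (a : M.Tuple Θ) : (Subst.pair τ ρ).eval a = Str.pair (τ.eval a) (ρ.eval a) := by
  funext v; rcases v with v | v <;> rfl

theorem Subst.eval_comp {M : Str L} {Γ Δ Θ : Ctx L.Sorts} (τ : Subst L Γ Δ) (ρ : Subst L Δ Θ)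
    (a : M.Tuple Θ) : (τ.comp ρ).eval a = τ.eval (ρ.eval a) := by
  funext v; exact Term.eval_subst _ _ _

@[simp] theorem Subst.eval_left {M : Str L} {Γ Δ : Ctx L.Sorts} (a : M.Tuple Γ) (b : M.Tuple Δ) :
    (Subst.left Γ Δ).eval (Str.pair a b) = a := rfl

@[simp] theorem Subst.eval_right {M : Str L} {Γ Δ : Ctx L.Sorts} (a : M.Tuple Γ) (b : M.Tuple Δ) :
    (Subst.right Γ Δ).eval (Str.pair a b) = b := rfl

theorem Formula.holds_subst {M : Str L} {Γ Δ : Ctx L.Sorts} (τ : Subst L Γ Δ) (φ : Formula L Γ)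
    (a : M.Tuple Δ) : (φ.subst τ).Holds a ↔ φ.Holds (τ.eval a) := by
  induction φ generalizing Δ with
  | top => rfl
  | bot => rfl
  | eq t t' => simp only [Formula.subst, Formula.Holds, Term.eval_subst]
  | rel R ts => simp only [Formula.subst, Formula.Holds, Term.eval_subst]
  | and φ ψ ihφ ihψ => simp only [Formula.subst, Formula.Holds, ihφ, ihψ]
  | or φ ψ ihφ ihψ => simp only [Formula.subst, Formula.Holds, ihφ, ihψ]
  | ex Θ φ ih =>
    simp only [Formula.subst, Formula.Holds, ih, Subst.eval_pair, Subst.eval_comp,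
      Subst.eval_left, Subst.eval_right]

theorem Formula.holds_eqs {M : Str L} {Γ Δ : Ctx L.Sorts} (t t' : Subst L Γ Δ) (a : M.Tuple Δ) :
    (Formula.eqs t t').Holds a ↔ t.eval a = t'.eval a := by
  induction Γ with
  | nil => exact ⟨fun _ => funext fun v => v.elim, fun _ => trivial⟩
  | single s => exact ⟨fun h => funext fun _ => h, fun h => congrFun h ()⟩
  | append Γ₁ Γ₂ ih₁ ih₂ =>
    refine (and_congr (ih₁ (fun v => t (Sum.inl v)) (fun v => t' (Sum.inl v)))
      (ih₂ (fun v => t (Sum.inr v)) (fun v => t' (Sum.inr v)))).trans ⟨?_, ?_⟩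
    · rintro ⟨h₁, h₂⟩
      funext v
      rcases v with v | v
      · exact congrFun h₁ v
      · exact congrFun h₂ v
    · intro h
      exact ⟨funext fun v => congrFun h (Sum.inl v), funext fun v => congrFun h (Sum.inr v)⟩

theorem Str.exists_pair {M : Str L} {Γ Δ : Ctx L.Sorts} (c : M.Tuple (Γ.append Δ)) :
    ∃ a b, c = Str.pair a b :=
  ⟨fun v => c (Sum.inl v), fun v => c (Sum.inr v), by funext v; rcases v with v | v <;> rfl⟩

/-- Homomorphisms of structures: they commute with the function symbols and preserve the
relation symbols. -/
@[ext] structure Str.Hom (M N : Str L) : Type u where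
  toFun (s : L.Sorts) : M.carrier s → N.carrier s
  map_fn (f : L.Fn) (a : M.Tuple (L.dom f)) :
    toFun _ (M.fn f a) = N.fn f fun v => toFun _ (a v)
  map_rel (R : L.Rel) (a : M.Tuple (L.arity R)) :
    M.rel R a → N.rel R fun v => toFun _ (a v)

/-- The image of a tuple. -/
def Str.Hom.onTuple {M N : Str L} (f : M.Hom N) {Γ : Ctx L.Sorts} (a : M.Tuple Γ) : N.Tuple Γ :=
  fun v => f.toFun _ (a v)

theorem Str.Hom.onTuple_pair {M N : Str L} (f : M.Hom N) {Γ Δ : Ctx L.Sorts} (a : M.Tuple Γ)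
    (b : M.Tuple Δ) : f.onTuple (Str.pair a b) = Str.pair (f.onTuple a) (f.onTuple b) := by
  funext v; rcases v with v | v <;> rfl

theorem Str.Hom.map_eval {M N : Str L} (f : M.Hom N) {Γ : Ctx L.Sorts} (a : M.Tuple Γ)
    {s : L.Sorts} (t : Term L Γ s) : f.toFun s (t.eval a) = t.eval (f.onTuple a) := by
  induction t with
  | var v => rfl
  | app g ts ih => simp only [Term.eval, f.map_fn, ih]

/-- Homomorphisms preserve satisfaction of coherent formulas. -/
theorem Str.Hom.map_holds {M N : Str L} (f : M.Hom N) {Γ : Ctx L.Sorts} (φ : Formula L Γ)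
    (a : M.Tuple Γ) : φ.Holds a → φ.Holds (f.onTuple a) := by
  induction φ with
  | top => exact id
  | bot => exact id
  | eq t t' =>
    intro h
    change _ = _ at h
    change _ = _
    rw [← f.map_eval, ← f.map_eval, h]
  | rel R ts =>
    intro h
    have := f.map_rel R _ h
    simp only [f.map_eval] at this
    exact this
  | and φ ψ ihφ ihψ => exact fun h => ⟨ihφ _ h.1, ihψ _ h.2⟩
  | or φ ψ ihφ ihψ => exact fun h => h.imp (ihφ _) (ihψ _)
  | ex Θ φ ih =>
    rintro ⟨b, hb⟩
    have := ih _ hb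
    rw [f.onTuple_pair] at this
    exact ⟨_, this⟩

/-- Immersions: homomorphisms that also reflect satisfaction of coherent formulas. -/
def Str.Hom.IsImmersion {M N : Str L} (f : M.Hom N) : Prop :=
  ∀ ⦃Γ : Ctx L.Sorts⦄ (φ : Formula L Γ) (a : M.Tuple Γ), φ.Holds (f.onTuple a) → φ.Holds a

end Semantics

/-! ### Coherent theories and their models in `Set` -/

/-- A coherent sequent `φ ⊢_x ψ`. -/
structure Sequent (L : Signature.{u}) : Type u where
  ctx : Ctx L.Sorts
  lhs : Formula L ctx
  rhs : Formula L ctx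

/-- A coherent theory is a set of coherent sequents. -/
structure Theory (L : Signature.{u}) : Type u where
  axs : Set (Sequent L)

variable {L : Signature.{u}}

/-- The models of `T` in `Set`. -/
structure Theory.Model (T : Theory L) : Type (u + 1) extends Str L where
  sat : ∀ A ∈ T.axs, ∀ a : toStr.Tuple A.ctx, A.lhs.Holds a → A.rhs.Holds a

instance (T : Theory L) : Category.{u} T.Model where
  Hom M N := M.toStr.Hom N.toStr
  id M :=
    { toFun := fun _ x => x
      map_fn := fun _ _ => rfl
      map_rel := fun _ _ h => h }
  comp f g :=
    { toFun := fun s x => g.toFun s (f.toFun s x)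
      map_fn := fun h a => by rw [f.map_fn, g.map_fn]
      map_rel := fun R a h => g.map_rel R _ (f.map_rel R a h) }

/-- `T` proves the sequent `φ ⊢_x ψ`, in the model-theoretic sense (as for `⊨ᵇ` in Mathlib): the
sequent is a consequence of `T`, i.e. holds in all models of `T` in `Set`, where sorts may be
empty. By completeness of coherent logic this is derivability. -/
def Theory.Proves (T : Theory L) {Γ : Ctx L.Sorts} (φ ψ : Formula L Γ) : Prop :=
  ∀ (M : T.Model) (a : M.toStr.Tuple Γ), φ.Holds a → ψ.Holds a

/-- The amalgamation property for `Set`-models. -/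
def Theory.Amalgamation (T : Theory L) : Prop :=
  ∀ ⦃M₀ M₁ M₂ : T.Model⦄ (f₁ : M₀ ⟶ M₁) (f₂ : M₀ ⟶ M₂),
    ∃ (N : T.Model) (g₁ : M₁ ⟶ N) (g₂ : M₂ ⟶ N), f₁ ≫ g₁ = f₂ ≫ g₂

/-- Existentially closed models in `Set`. -/
def Theory.Model.IsEC {T : Theory L} (M : T.Model) : Prop :=
  ∀ ⦃N : T.Model⦄ (f : M ⟶ N), Str.Hom.IsImmersion f

/-- Strongly existentially closed models in `Set`. -/
def Theory.Model.IsSEC {T : Theory L} (M : T.Model) : Prop :=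
  ∀ ⦃Γ : Ctx L.Sorts⦄ (φ : Formula L Γ) (a : M.toStr.Tuple Γ), ¬ φ.Holds a →
    ∃ ψ : Formula L Γ, T.Proves (.and φ ψ) .bot ∧ ψ.Holds a

/-! ### The syntactic category and the classifying topos -/

/-- Objects of the syntactic category of `T`: coherent formulas in context `{x . φ}`. -/
structure SynCat (T : Theory L) : Type u where
  ctx : Ctx L.Sorts
  form : Formula L ctx

namespace SynCat

variable {T : Theory L}

/-- The interpretation `φ(M)` of a formula in context. -/
def Interp (X : SynCat T) (M : T.Model) : Type u :=
  {a : M.toStr.Tuple X.ctx // X.form.Holds a}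

/-- Formulas `θ(x, y)` that are `T`-provably functional relations from `{x . φ}` to `{y . ψ}`:
`T` proves `θ(x, y) ⊢ φ(x) ∧ ψ(y)` and `φ(x) ⊢ ∃! y θ(x, y)`. -/
def FunForm (X Y : SynCat T) : Type u :=
  {θ : Formula L (X.ctx.append Y.ctx) // ∀ M : T.Model,
    (∀ (a : M.toStr.Tuple X.ctx) (b : M.toStr.Tuple Y.ctx),
      θ.Holds (Str.pair a b) → X.form.Holds a ∧ Y.form.Holds b) ∧
    (∀ a : M.toStr.Tuple X.ctx, X.form.Holds a → ∃! b : M.toStr.Tuple Y.ctx,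
      θ.Holds (Str.pair a b))}

/-- `T`-provable equivalence. -/
instance funSetoid (X Y : SynCat T) : Setoid (FunForm X Y) where
  r θ θ' := T.Proves θ.1 θ'.1 ∧ T.Proves θ'.1 θ.1
  iseqv :=
    { refl := fun _ => ⟨fun _ _ h => h, fun _ _ h => h⟩
      symm := fun h => ⟨h.2, h.1⟩
      trans := fun h h' => ⟨fun M a ha => h'.1 M a (h.1 M a ha),
        fun M a ha => h.2 M a (h'.2 M a ha)⟩ }

/-- Morphisms of the syntactic category: `T`-provable equivalence classes of `T`-provably
functional formulas. -/
def Mor (X Y : SynCat T) : Type u := Quotient (funSetoid X Y)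

/-- The relation defined by a morphism in a model of `T`. -/
def Mor.Graph {X Y : SynCat T} (f : Mor X Y) (M : T.Model) (a : M.toStr.Tuple X.ctx)
    (b : M.toStr.Tuple Y.ctx) : Prop :=
  Quotient.lift (fun θ : FunForm X Y => θ.1.Holds (Str.pair a b))
    (fun θ θ' (h : T.Proves θ.1 θ'.1 ∧ T.Proves θ'.1 θ.1) => propext ⟨h.1 M _, h.2 M _⟩) f

theorem Mor.ext {X Y : SynCat T} {f g : Mor X Y}
    (h : ∀ (M : T.Model) a b, f.Graph M a b ↔ g.Graph M a b) : f = g := by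
  induction f using Quotient.inductionOn with
  | h θ =>
    induction g using Quotient.inductionOn with
    | h θ' =>
      apply Quotient.sound
      constructor
      · intro M c hc
        obtain ⟨a, b, rfl⟩ := Str.exists_pair c
        exact (h M a b).1 hc
      · intro M c hc
        obtain ⟨a, b, rfl⟩ := Str.exists_pair c
        exact (h M a b).2 hc

theorem Mor.graph_holds {X Y : SynCat T} (f : Mor X Y) {M : T.Model} {a : M.toStr.Tuple X.ctx}
    {b : M.toStr.Tuple Y.ctx} (h : f.Graph M a b) : X.form.Holds a ∧ Y.form.Holds b := by
  induction f using Quotient.inductionOn with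
  | h θ => exact (θ.2 M).1 a b h

theorem Mor.existsUnique {X Y : SynCat T} (f : Mor X Y) {M : T.Model} {a : M.toStr.Tuple X.ctx}
    (h : X.form.Holds a) : ∃! b, f.Graph M a b := by
  induction f using Quotient.inductionOn with
  | h θ => exact (θ.2 M).2 a h

theorem Mor.graph_unique {X Y : SynCat T} (f : Mor X Y) {M : T.Model} {a : M.toStr.Tuple X.ctx}
    {b b' : M.toStr.Tuple Y.ctx} (h : f.Graph M a b) (h' : f.Graph M a b') : b = b' :=
  (f.existsUnique (f.graph_holds h).1).unique h h'

/-- Homomorphisms of models preserve the graphs of morphisms. -/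
theorem Mor.graph_map {X Y : SynCat T} (f : Mor X Y) {M N : T.Model} (g : M ⟶ N)
    {a : M.toStr.Tuple X.ctx} {b : M.toStr.Tuple Y.ctx} (h : f.Graph M a b) :
    f.Graph N (Str.Hom.onTuple g a) (Str.Hom.onTuple g b) := by
  induction f using Quotient.inductionOn with
  | h θ =>
    have := Str.Hom.map_holds g θ.1 _ h
    rw [Str.Hom.onTuple_pair] at this
    exact this

/-- A functional formula for the identity: `φ(x) ∧ x = x'`. -/
def idForm (X : SynCat T) : FunForm X X :=
  ⟨.and (X.form.subst (Subst.left X.ctx X.ctx))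
      (Formula.eqs (Subst.left X.ctx X.ctx) (Subst.right X.ctx X.ctx)), by
    intro M
    simp only [Formula.Holds, Formula.holds_subst, Formula.holds_eqs, Subst.eval_left,
      Subst.eval_right]
    constructor
    · rintro a b ⟨h, rfl⟩
      exact ⟨h, h⟩
    · intro a h
      exact ⟨a, ⟨h, rfl⟩, fun b hb => hb.2.symm⟩⟩

/-- The composite formula `∃ y (θ(x, y) ∧ θ'(y, z))`. -/
def compFormula {X Y Z : SynCat T} (θ : FunForm X Y) (θ' : FunForm Y Z) :
    Formula L (X.ctx.append Z.ctx) :=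
  .ex Y.ctx (.and
    (θ.1.subst (Subst.pair ((Subst.left X.ctx Z.ctx).comp (Subst.left (X.ctx.append Z.ctx) Y.ctx))
      (Subst.right (X.ctx.append Z.ctx) Y.ctx)))
    (θ'.1.subst (Subst.pair (Subst.right (X.ctx.append Z.ctx) Y.ctx)
      ((Subst.right X.ctx Z.ctx).comp (Subst.left (X.ctx.append Z.ctx) Y.ctx)))))

theorem holds_compFormula {X Y Z : SynCat T} (θ : FunForm X Y) (θ' : FunForm Y Z) (M : T.Model)
    (a : M.toStr.Tuple X.ctx) (c : M.toStr.Tuple Z.ctx) :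
    (compFormula θ θ').Holds (Str.pair a c) ↔
      ∃ b : M.toStr.Tuple Y.ctx, θ.1.Holds (Str.pair a b) ∧ θ'.1.Holds (Str.pair b c) := by
  simp only [compFormula, Formula.Holds, Formula.holds_subst, Subst.eval_pair, Subst.eval_comp,
    Subst.eval_left, Subst.eval_right]

def compForm {X Y Z : SynCat T} (θ : FunForm X Y) (θ' : FunForm Y Z) : FunForm X Z :=
  ⟨compFormula θ θ', by
    intro M
    simp only [holds_compFormula]
    constructor
    · rintro a c ⟨b, h, h'⟩
      exact ⟨((θ.2 M).1 _ _ h).1, ((θ'.2 M).1 _ _ h').2⟩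
    · intro a ha
      obtain ⟨b, hb, hbu⟩ := (θ.2 M).2 a ha
      obtain ⟨c, hc, hcu⟩ := (θ'.2 M).2 b ((θ.2 M).1 _ _ hb).2
      refine ⟨c, ⟨b, hb, hc⟩, ?_⟩
      rintro c' ⟨b', hb', hc'⟩
      obtain rfl := hbu b' hb'
      exact hcu c' hc'⟩

def Mor.id (X : SynCat T) : Mor X X := Quotient.mk _ (idForm X)

def Mor.comp {X Y Z : SynCat T} (f : Mor X Y) (g : Mor Y Z) : Mor X Z :=
  Quotient.map₂ compForm (by
    intro θ₁ θ₂ h θ₁' θ₂' h'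
    constructor
    · intro M d hd
      obtain ⟨a, c, rfl⟩ := Str.exists_pair d
      obtain ⟨b, hb, hc⟩ := (holds_compFormula _ _ M a c).1 hd
      exact (holds_compFormula _ _ M a c).2 ⟨b, h.1 M _ hb, h'.1 M _ hc⟩
    · intro M d hd
      obtain ⟨a, c, rfl⟩ := Str.exists_pair d
      obtain ⟨b, hb, hc⟩ := (holds_compFormula _ _ M a c).1 hd
      exact (holds_compFormula _ _ M a c).2 ⟨b, h.2 M _ hb, h'.2 M _ hc⟩) f g

theorem Mor.graph_id (X : SynCat T) (M : T.Model) (a b : M.toStr.Tuple X.ctx) :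
    (Mor.id X).Graph M a b ↔ X.form.Holds a ∧ a = b := by
  change (idForm X).1.Holds (Str.pair a b) ↔ _
  simp only [idForm, Formula.Holds, Formula.holds_subst, Formula.holds_eqs, Subst.eval_left,
    Subst.eval_right]

theorem Mor.graph_comp {X Y Z : SynCat T} (f : Mor X Y) (g : Mor Y Z) (M : T.Model)
    (a : M.toStr.Tuple X.ctx) (c : M.toStr.Tuple Z.ctx) :
    (f.comp g).Graph M a c ↔ ∃ b, f.Graph M a b ∧ g.Graph M b c := by
  induction f using Quotient.inductionOn with
  | h θ =>
    induction g using Quotient.inductionOn with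
    | h θ' => exact holds_compFormula θ θ' M a c

/-- The syntactic category of `T`. -/
instance : Category.{u} (SynCat T) where
  Hom := Mor
  id := Mor.id
  comp := Mor.comp
  id_comp f := Mor.ext fun M a b => by
    rw [Mor.graph_comp]
    constructor
    · rintro ⟨c, hc, h⟩
      obtain ⟨_, rfl⟩ := (Mor.graph_id _ _ _ _).1 hc
      exact h
    · exact fun h => ⟨a, (Mor.graph_id _ _ _ _).2 ⟨(f.graph_holds h).1, rfl⟩, h⟩
  comp_id f := Mor.ext fun M a b => by
    rw [Mor.graph_comp]
    constructor
    · rintro ⟨c, h, hc⟩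
      obtain ⟨_, rfl⟩ := (Mor.graph_id _ _ _ _).1 hc
      exact h
    · exact fun h => ⟨b, h, (Mor.graph_id _ _ _ _).2 ⟨(f.graph_holds h).2, rfl⟩⟩
  assoc f g h := Mor.ext fun M a d => by
    simp only [Mor.graph_comp]
    constructor
    · rintro ⟨c, ⟨b, h₁, h₂⟩, h₃⟩
      exact ⟨b, h₁, c, h₂, h₃⟩
    · rintro ⟨b, h₁, c, h₂, h₃⟩
      exact ⟨c, ⟨b, h₁, h₂⟩, h₃⟩

/-- The function `φ(M) → ψ(M)` defined by a morphism of the syntactic category. -/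
noncomputable def Mor.fn {X Y : SynCat T} (f : Mor X Y) (M : T.Model) (a : X.Interp M) :
    Y.Interp M :=
  ⟨(f.existsUnique a.2).choose, (f.graph_holds (f.existsUnique a.2).choose_spec.1).2⟩

theorem Mor.graph_fn {X Y : SynCat T} (f : Mor X Y) (M : T.Model) (a : X.Interp M) :
    f.Graph M a.1 (f.fn M a).1 :=
  (f.existsUnique a.2).choose_spec.1

theorem Mor.fn_eq {X Y : SynCat T} (f : Mor X Y) (M : T.Model) (a : X.Interp M) (b : Y.Interp M)
    (h : f.Graph M a.1 b.1) : f.fn M a = b :=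
  Subtype.ext (f.graph_unique (f.graph_fn M a) h)

theorem Mor.fn_id (X : SynCat T) (M : T.Model) (a : X.Interp M) : Mor.fn (𝟙 X) M a = a :=
  Mor.fn_eq _ _ _ _ ((Mor.graph_id _ _ _ _).2 ⟨a.2, rfl⟩)

theorem Mor.fn_comp {X Y Z : SynCat T} (f : X ⟶ Y) (g : Y ⟶ Z) (M : T.Model) (a : X.Interp M) :
    Mor.fn (f ≫ g) M a = Mor.fn g M (Mor.fn f M a) :=
  Mor.fn_eq _ _ _ _ ((Mor.graph_comp _ _ _ _ _).2 ⟨_, Mor.graph_fn f M a, Mor.graph_fn g M _⟩)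

/-- The action of a homomorphism of models on the interpretation of a formula. -/
def onInterp (X : SynCat T) {M N : T.Model} (g : M ⟶ N) (a : X.Interp M) : X.Interp N :=
  ⟨Str.Hom.onTuple g a.1, Str.Hom.map_holds g _ _ a.2⟩

theorem onInterp_fn {X Y : SynCat T} (f : X ⟶ Y) {M N : T.Model} (g : M ⟶ N) (a : X.Interp M) :
    Mor.fn f N (X.onInterp g a) = Y.onInterp g (Mor.fn f M a) :=
  Mor.fn_eq _ _ _ _ (Mor.graph_map f g (Mor.graph_fn f M a))

/-- The family of functions `φᵢ(M) → φ(M)` defined by a finite list of morphisms into `{x . φ}`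
is jointly surjective in every model of `T`, i.e. `T` proves `φ(x) ⊢ ⋁ᵢ ∃ yᵢ θᵢ(yᵢ, x)`. -/
def JointlyCovers {X : SynCat T} (l : List (Σ Y : SynCat T, (Y ⟶ X))) : Prop :=
  ∀ (M : T.Model) (a : X.Interp M), ∃ g ∈ l, ∃ b : g.1.Interp M, Mor.fn g.2 M b = a

/-- The pullback object `{(y, x') . ∃ x (θ(y, x) ∧ θ'(x', x))}`. -/
def pullbackObj {X Y X' : SynCat T} (θ : FunForm Y X) (θ' : FunForm X' X) : SynCat T where
  ctx := Y.ctx.append X'.ctx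
  form := .ex X.ctx (.and
    (θ.1.subst (Subst.pair ((Subst.left Y.ctx X'.ctx).comp (Subst.left (Y.ctx.append X'.ctx) X.ctx))
      (Subst.right (Y.ctx.append X'.ctx) X.ctx)))
    (θ'.1.subst (Subst.pair
      ((Subst.right Y.ctx X'.ctx).comp (Subst.left (Y.ctx.append X'.ctx) X.ctx))
      (Subst.right (Y.ctx.append X'.ctx) X.ctx))))

theorem holds_pullbackObj {X Y X' : SynCat T} (θ : FunForm Y X) (θ' : FunForm X' X) (M : T.Model)
    (b : M.toStr.Tuple Y.ctx) (a' : M.toStr.Tuple X'.ctx) :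
    (pullbackObj θ θ').form.Holds (Str.pair b a' : M.toStr.Tuple (Y.ctx.append X'.ctx)) ↔
      ∃ a : M.toStr.Tuple X.ctx, θ.1.Holds (Str.pair b a) ∧ θ'.1.Holds (Str.pair a' a) := by
  simp only [pullbackObj, Formula.Holds, Formula.holds_subst, Subst.eval_pair, Subst.eval_comp,
    Subst.eval_left, Subst.eval_right]

/-- A morphism given by a tuple of terms. -/
def termForm {X Y : SynCat T} (τ : Subst L Y.ctx X.ctx)
    (h : ∀ (M : T.Model) (a : M.toStr.Tuple X.ctx), X.form.Holds a → Y.form.Holds (τ.eval a)) :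
    FunForm X Y :=
  ⟨.and (X.form.subst (Subst.left X.ctx Y.ctx))
      (Formula.eqs (τ.comp (Subst.left X.ctx Y.ctx)) (Subst.right X.ctx Y.ctx)), by
    intro M
    simp only [Formula.Holds, Formula.holds_subst, Formula.holds_eqs, Subst.eval_left,
      Subst.eval_right, Subst.eval_comp]
    constructor
    · rintro a b ⟨ha, rfl⟩
      exact ⟨ha, h M a ha⟩
    · intro a ha
      exact ⟨_, ⟨ha, rfl⟩, fun b hb => hb.2.symm⟩⟩

theorem graph_termForm {X Y : SynCat T} (τ : Subst L Y.ctx X.ctx)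
    (h : ∀ (M : T.Model) (a : M.toStr.Tuple X.ctx), X.form.Holds a → Y.form.Holds (τ.eval a))
    (M : T.Model) (a : M.toStr.Tuple X.ctx) (b : M.toStr.Tuple Y.ctx) :
    Mor.Graph (Quotient.mk _ (termForm τ h)) M a b ↔ X.form.Holds a ∧ τ.eval a = b := by
  change (termForm τ h).1.Holds (Str.pair a b) ↔ _
  simp only [termForm, Formula.Holds, Formula.holds_subst, Formula.holds_eqs, Subst.eval_left,
    Subst.eval_right, Subst.eval_comp]

/-- Weak pullbacks in the syntactic category, computed as in models. -/
theorem exists_pullback {X Y X' : SynCat T} (f : Y ⟶ X) (f' : X' ⟶ X) :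
    ∃ (P : SynCat T) (q : P ⟶ Y) (q' : P ⟶ X'), q ≫ f = q' ≫ f' ∧
      ∀ (M : T.Model) (b : Y.Interp M) (a' : X'.Interp M), Mor.fn f M b = Mor.fn f' M a' →
        ∃ c : P.Interp M, Mor.fn q' M c = a' := by
  induction f using Quotient.inductionOn with
  | h θ =>
  induction f' using Quotient.inductionOn with
  | h θ' =>
  have hY : ∀ (M : T.Model) (c : M.toStr.Tuple (pullbackObj θ θ').ctx),
      (pullbackObj θ θ').form.Holds c →
      Y.form.Holds ((Subst.left Y.ctx X'.ctx : Subst L Y.ctx (pullbackObj θ θ').ctx).eval c) := by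
    intro M c hc
    obtain ⟨b, a', rfl⟩ := Str.exists_pair (Γ := Y.ctx) (Δ := X'.ctx) c
    obtain ⟨a, h, -⟩ := (holds_pullbackObj θ θ' M b a').1 hc
    exact ((θ.2 M).1 _ _ h).1
  have hX' : ∀ (M : T.Model) (c : M.toStr.Tuple (pullbackObj θ θ').ctx),
      (pullbackObj θ θ').form.Holds c →
      X'.form.Holds
        ((Subst.right Y.ctx X'.ctx : Subst L X'.ctx (pullbackObj θ θ').ctx).eval c) := by
    intro M c hc
    obtain ⟨b, a', rfl⟩ := Str.exists_pair (Γ := Y.ctx) (Δ := X'.ctx) c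
    obtain ⟨a, -, h⟩ := (holds_pullbackObj θ θ' M b a').1 hc
    exact ((θ'.2 M).1 _ _ h).1
  refine ⟨pullbackObj θ θ', Quotient.mk _ (termForm _ hY), Quotient.mk _ (termForm _ hX'),
    ?_, ?_⟩
  · refine Mor.ext fun M c a => ?_
    refine (Mor.graph_comp _ _ _ _ _).trans (Iff.trans ?_ (Mor.graph_comp _ _ _ _ _).symm)
    obtain ⟨b, a', rfl⟩ := Str.exists_pair (Γ := Y.ctx) (Δ := X'.ctx) c
    constructor
    · rintro ⟨_, hb, h⟩
      obtain ⟨hc, rfl⟩ := (graph_termForm _ hY _ _ _).1 hb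
      refine ⟨_, (graph_termForm _ hX' _ _ _).2 ⟨hc, rfl⟩, ?_⟩
      obtain ⟨a₀, h₁, h₂⟩ := (holds_pullbackObj θ θ' M b a').1 hc
      obtain rfl : a₀ = a := Mor.graph_unique (Quotient.mk _ θ) h₁ h
      exact h₂
    · rintro ⟨_, hb, h⟩
      obtain ⟨hc, rfl⟩ := (graph_termForm _ hX' _ _ _).1 hb
      refine ⟨_, (graph_termForm _ hY _ _ _).2 ⟨hc, rfl⟩, ?_⟩
      obtain ⟨a₀, h₁, h₂⟩ := (holds_pullbackObj θ θ' M b a').1 hc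
      obtain rfl : a₀ = a := Mor.graph_unique (Quotient.mk _ θ') h₂ h
      exact h₁
  · intro M b a' h
    have h₁ := Mor.graph_fn (Quotient.mk _ θ) M b
    have h₂ := Mor.graph_fn (Quotient.mk _ θ') M a'
    change Mor.fn (Quotient.mk _ θ) M b = Mor.fn (Quotient.mk _ θ') M a' at h
    rw [h] at h₁
    have hc := (holds_pullbackObj θ θ' M b.1 a'.1).2 ⟨_, h₁, h₂⟩
    exact ⟨⟨_, hc⟩, Mor.fn_eq _ _ _ _ ((graph_termForm _ hX' _ _ _).2 ⟨hc, rfl⟩)⟩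

end SynCat

open SynCat in
/-- The coherent topology on the syntactic category: a sieve on `{x . φ}` is covering if it
contains finitely many morphisms `θᵢ` such that `T` proves `φ(x) ⊢ ⋁ᵢ ∃ yᵢ θᵢ(yᵢ, x)`. -/
def Theory.topology (T : Theory L) : GrothendieckTopology (SynCat T) where
  sieves X := {S | ∃ l : List (Σ Y : SynCat T, (Y ⟶ X)), (∀ g ∈ l, S g.2) ∧ JointlyCovers l}
  top_mem' X := ⟨[⟨X, 𝟙 X⟩], fun _ _ => trivial, fun M a =>
    ⟨_, List.mem_singleton.2 rfl, a, Mor.fn_id X M a⟩⟩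
  pullback_stable' := by
    rintro X X' S f' ⟨l, hl, hcov⟩
    choose P q q' hq hP using fun g : (Σ Y : SynCat T, (Y ⟶ X)) => exists_pullback g.2 f'
    refine ⟨l.map fun g => ⟨P g, q' g⟩, ?_, ?_⟩
    · intro g hg
      obtain ⟨g, hgl, rfl⟩ := List.mem_map.1 hg
      change S (q' g ≫ f')
      rw [← hq]
      exact S.downward_closed (hl g hgl) _
    · intro M a'
      obtain ⟨g, hgl, b, hb⟩ := hcov M (Mor.fn f' M a')
      obtain ⟨c, hc⟩ := hP g M b a' hb
      exact ⟨_, List.mem_map.2 ⟨g, hgl, rfl⟩, c, hc⟩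
  transitive' := by
    rintro X S ⟨l, hl, hcov⟩ R hR
    have hR' : ∀ g : (Σ Y : SynCat T, (Y ⟶ X)), ∃ l' : List (Σ Z : SynCat T, (Z ⟶ g.1)),
        g ∈ l → (∀ h ∈ l', R (h.2 ≫ g.2)) ∧ JointlyCovers l' := by
      intro g
      by_cases hg : g ∈ l
      · obtain ⟨l', h₁, h₂⟩ := hR (hl g hg)
        exact ⟨l', fun _ => ⟨h₁, h₂⟩⟩
      · exact ⟨[], fun h => absurd h hg⟩
    choose l' hl' using hR'
    refine ⟨l.flatMap fun g => (l' g).map fun h => ⟨h.1, h.2 ≫ g.2⟩, ?_, ?_⟩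
    · intro k hk
      obtain ⟨g, hg, hk⟩ := List.mem_flatMap.1 hk
      obtain ⟨h, hh, rfl⟩ := List.mem_map.1 hk
      exact (hl' g hg).1 h hh
    · intro M a
      obtain ⟨g, hg, b, hb⟩ := hcov M a
      obtain ⟨h, hh, c, hc⟩ := (hl' g hg).2 M b
      refine ⟨_, List.mem_flatMap.2 ⟨g, hg, List.mem_map.2 ⟨h, hh, rfl⟩⟩, c, ?_⟩
      exact (Mor.fn_comp _ _ M c).trans (by rw [hc, hb])

/-- The classifying topos `Set[T]`: sheaves on the syntactic site of `T`. -/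
abbrev Theory.ClassifyingTopos (T : Theory L) : Type (u + 1) :=
  Sheaf T.topology (Type u)

/-- The interpretation `φ(G_T)` of formulas in the generic model, with the action of provably
functional formulas: the sheaves associated to the representable presheaves. -/
noncomputable def Theory.generic (T : Theory L) : SynCat T ⥤ T.ClassifyingTopos :=
  yoneda ⋙ presheafToSheaf T.topology (Type u)

/-- The interpretation of formulas in models, `M ↦ ({x . φ} ↦ φ(M))`, functorial in
homomorphisms of models. -/
noncomputable def Theory.interp (T : Theory L) : T.Model ⥤ SynCat T ⥤ Type u where
  obj M :=
    { obj := fun X => X.Interp M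
      map := fun f => TypeCat.ofHom (SynCat.Mor.fn f M)
      map_id := fun X => by ext a; exact SynCat.Mor.fn_id X M a
      map_comp := fun f g => by ext a; exact SynCat.Mor.fn_comp f g M a }
  map g :=
    { app := fun X => TypeCat.ofHom (X.onInterp g)
      naturality := fun X Y f => by ext a; exact (SynCat.onInterp_fn f g a).symm }
  map_id M := by ext X a; rfl
  map_comp f g := by ext X a; rfl

/-! ### Geometric morphisms -/

/-- Geometric morphisms `F → E`. -/
structure GeomMorphism (F : Type u₁) [Category.{v₁} F] (E : Type u₂) [Category.{v₂} E] where
  inverse : E ⥤ F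
  direct : F ⥤ E
  adj : inverse ⊣ direct
  preservesFiniteLimits : Limits.PreservesFiniteLimits inverse

/-- `N` is a pseudo-complement of `A`: the largest element disjoint from `A`. -/
def IsPseudoCompl {α : Type*} [PartialOrder α] (A N : α) : Prop :=
  IsGreatest {C : α | ∀ D, D ≤ C → D ≤ A → IsBot D} N

namespace GeomMorphism

variable {F : Type u₁} [Category.{v₁} F] {E : Type u₂} [Category.{v₂} E]

/-- A natural transformation `p ⇒ q` of geometric morphisms (that is, `p^* ⟶ q^*`) is an
immersion if its naturality squares at monomorphisms are pullbacks. -/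
def IsImmersion {p q : GeomMorphism F E} (η : p.inverse ⟶ q.inverse) : Prop :=
  ∀ ⦃A X : E⦄ (a : A ⟶ X) [Mono a],
    IsPullback (η.app A) (p.inverse.map a) (q.inverse.map a) (η.app X)

/-- Existentially closed geometric morphisms. -/
def IsEC (p : GeomMorphism F E) : Prop :=
  ∀ (q : GeomMorphism F E) (η : p.inverse ⟶ q.inverse), IsImmersion η

/-- The subobject `A ≤ X` is complemented along `p`: `p^*(A ∨ ¬ A) = p^*(X)`. -/
def ComplementedAlong (p : GeomMorphism F E) {X : E} (A : Subobject X) : Prop :=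
  ∃ N D : Subobject X, IsPseudoCompl A N ∧ IsLUB {A, N} D ∧ IsIso (p.inverse.map D.arrow)

/-- Strongly existentially closed geometric morphisms: for some (small) generating set
`(X i)` of objects and some subobject basis `(B i)`, where `B i` is a set of subobjects of `X i`
such that every subobject of `X i` is a join of elements of `B i`, all subobjects in the basis are
complemented along `p`. -/
def IsSEC (p : GeomMorphism F E) : Prop :=
  ∃ (ι : Type v₂) (X : ι → E) (B : ∀ i, Set (Subobject (X i))),
    (ObjectProperty.ofObj X).IsSeparating ∧
    (∀ i (A : Subobject (X i)), ∃ s ⊆ B i, IsLUB s A) ∧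
    ∀ i, ∀ A ∈ B i, p.ComplementedAlong A

end GeomMorphism

/-! ### Models in `Set^G` for a monoid `G` -/

/-- The topos `Set^G` for a monoid `G`. -/
abbrev SetAct (G : Type) [Monoid G] : Type (u + 1) := SingleObj G ⥤ Type u

/-- The geometric morphism `p : Set^G → Set[T]` corresponds to the model `A` of `T` in `Set^G`
(a model of `T` in `Set` with an action of `G`): the inverse image under `p` of the generic model
is `A`, i.e. `p^*(φ(G_T)) ≅ φ(A)`, naturally. -/
def Classifies {T : Theory L} {G : Type} [Monoid G]
    (p : GeomMorphism (SetAct.{u} G) T.ClassifyingTopos) (A : SingleObj G ⥤ T.Model) : Prop :=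
  Nonempty (T.generic ⋙ p.inverse ≅ (A ⋙ T.interp).flip)

/-- The model `(M, σ)` in `Set^ℕ` given by a model `M` with an endomorphism `σ`. -/
def endoModel {T : Theory L} {M : T.Model} (σ : End M) :
    SingleObj (Multiplicative ℕ) ⥤ T.Model :=
  SingleObj.functor (powersHom (End M) σ)

/-- The model `(M, σ)` in `Set^ℤ` given by a model `M` with an automorphism `σ`. -/
def autoModel {T : Theory L} {M : T.Model} (σ : Aut M) :
    SingleObj (Multiplicative ℤ) ⥤ T.Model :=
  SingleObj.functor ((Aut.toEnd M).comp (zpowersHom (Aut M) σ))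

end CohLogic

/-!
The equivalence is proved for a model `A` of `T` in `Set^G`, for an arbitrary monoid `G`, with
underlying model `M`, and a geometric morphism `p` classifying `A`, as a cycle

  `M` s.e.c. ⟹ `p` s.e.c. ⟹ `p` e.c. ⟹ `M` e.c. ⟹ `M` s.e.c.

* `M` s.e.c. ⟹ `p` s.e.c. (`Theory.Model.IsSEC.isSEC_of_classifies`). The generating objects are
  the interpretations `χ(G_T)` of formulas in the generic model, and the basis consists of their
  definable subobjects. If `M ⊭ φ(a)`, a formula `ψ` true of `a` and incompatible with `φ` defines
  a subobject below the pseudo-complement of the one defined by `φ`. Joins and pseudo-complements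
  are computed on the sections of sheaves.
* `p` s.e.c. ⟹ `p` e.c. (`GeomMorphism.IsSEC.isEC`). An element of `p^*(X)` outside `p^*(A)`, with
  `A` in the basis, belongs to `p^*(¬ A)`, so that its image in `q^*(X)` is outside `q^*(A)`. This
  passes to all subobjects, since inverse image functors send jointly epic families to jointly
  surjective ones.
* `p` e.c. ⟹ `M` e.c. (`GeomMorphism.IsEC.isEC_of_classifies`). This is the only place where the
  monoid matters and amalgamation is used: a homomorphism `f : M ⟶ N` has to be extended to a
  homomorphism from `A` to some model in `Set^G`, which then yields a natural transformation out of
  `p^*` (`exists_extension`). For `ℕ`, repeated amalgamation of `f` and `σ ≫ f` produces a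
  sequence of models with a shift, which becomes an endomorphism of the colimit
  (`exists_equivariant_endomorphism`); for `ℤ`, the colimit of the iterates of this endomorphism
  turns it into an automorphism (`exists_equivariant_automorphism`).
* `M` e.c. ⟹ `M` s.e.c. (`Theory.Model.IsEC.isSEC`). This is a compactness argument with the
  positive diagram of `M`, carried out with an ultraproduct.

The geometric morphism classifying `A` exists because models of `T` are points of the syntactic
site, functorially in homomorphisms: its inverse image takes the fiber of a sheaf at `M`, with the
induced action of `G` (`classifyingMorphism`).
-/

namespace CohLogic

open Limits Opposite

/-! ### Strongly existentially closed geometric morphisms -/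

/-- A family of morphisms with common codomain (given as a presieve, so of any size) is jointly
epic if morphisms out of the codomain are determined by their restrictions along it. -/
def JointlyEpic {E : Type u₂} [Category.{v₂} E] {S : E} (P : Presieve S) : Prop :=
  ∀ ⦃W : E⦄ (u v : S ⟶ W), (∀ ⦃Z : E⦄ (t : Z ⟶ S), P t → t ≫ u = t ≫ v) → u = v

section JointlyEpic

variable {E : Type u₂} [Category.{v₂} E]

/-- In the presence of equalizers, the members of a family of subobjects jointly cover their
join: the equalizer of two morphisms out of the join that agree on all of them is a subobject
containing all of them. -/
theorem JointlyEpic.of_isLUB [HasEqualizers E] {X : E} {s : Set (Subobject X)} {A : Subobject X}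
    (h : IsLUB s A) :
    JointlyEpic fun Z (t : Z ⟶ (A : E)) =>
      ∃ C ∈ s, ∃ k : Z ⟶ (C : E), k ≫ C.arrow = t ≫ A.arrow := by
  intro W a b hab
  have hA : A ≤ Subobject.mk (equalizer.ι a b ≫ A.arrow) := by
    refine h.2 fun C hC => ?_
    have hCA := h.1 hC
    have := hab (C.ofLE A hCA) ⟨C, hC, 𝟙 _, by simp⟩
    exact Subobject.le_mk_of_comm (equalizer.lift _ this) (by simp)
  have h₁ : A.ofLEMk _ hA ≫ equalizer.ι a b = 𝟙 _ := by
    rw [← cancel_mono A.arrow, Category.assoc, Subobject.ofLEMk_comp, Category.id_comp]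
  rw [← Category.id_comp a, ← Category.id_comp b, ← h₁, Category.assoc, Category.assoc,
    equalizer.condition]

variable {G : Type} [Monoid G]

/-- The inverse image of a geometric morphism from `Set^G` sends jointly epic families to jointly
surjective ones. -/
theorem JointlyEpic.exists_preimage (p : GeomMorphism (SetAct.{u} G) E) {S : E} {P : Presieve S}
    (hP : JointlyEpic P) (x : (p.inverse.obj S).obj (SingleObj.star G)) :
    ∃ (Z : E) (t : Z ⟶ S) (_ : P t) (z : (p.inverse.obj Z).obj (SingleObj.star G)),
      (p.inverse.map t).app _ z = x := by
  let U : Set ((p.inverse.obj S).obj (SingleObj.star G)) :=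
    {x | ∃ (Z : E) (t : Z ⟶ S) (_ : P t) (z : (p.inverse.obj Z).obj (SingleObj.star G)),
      (p.inverse.map t).app _ z = x}
  have hU : ∀ (g : SingleObj.star G ⟶ SingleObj.star G) x, x ∈ U →
      (p.inverse.obj S).map g x ∈ U := by
    rintro g _ ⟨Z, t, ht, z, rfl⟩
    exact ⟨Z, t, ht, (p.inverse.obj Z).map g z, NatTrans.naturality_apply (p.inverse.map t) g z⟩
  -- The set of all maps `G → Prop`, with the cofree action of `G`: morphisms into it are
  -- arbitrary predicates. The characteristic function of `U` is compared with the constant `True`.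
  let Ω : SetAct.{u} G :=
    { obj := fun _ => ULift.{u} (G → Prop)
      map := fun {_ _} g => ↾fun w => ⟨fun h : G => w.down (h * (g : G))⟩
      map_id := fun _ => by
        ext w h
        exact iff_of_eq (congrArg w.down (mul_one h))
      map_comp := fun g h => by
        ext w k
        exact iff_of_eq (congrArg w.down (mul_assoc k h g).symm) }
  let a : p.inverse.obj S ⟶ Ω :=
    { app := fun _ => ↾fun x => ⟨fun h => (p.inverse.obj S).map
        (show SingleObj.star G ⟶ SingleObj.star G from h) x ∈ U⟩
      naturality := fun _ _ g => by
        ext x h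
        exact iff_of_eq (congrArg (· ∈ U) (Functor.map_comp_apply (p.inverse.obj S) g
          (show SingleObj.star G ⟶ SingleObj.star G from h) x).symm) }
  let b : p.inverse.obj S ⟶ Ω :=
    { app := fun _ => ↾fun x => ⟨fun _ => True⟩
      naturality := fun _ _ g => rfl }
  have hab : a = b := by
    apply (p.adj.homEquiv _ _).injective
    refine hP _ _ fun Z t ht => ?_
    rw [← p.adj.homEquiv_naturality_left, ← p.adj.homEquiv_naturality_left]
    congr 1
    ext _ z h
    refine iff_of_eq (eq_true ?_)
    exact hU _ _ ⟨Z, t, ht, z, rfl⟩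
  have := congrFun (congrArg ULift.down (ConcreteCategory.congr_hom (NatTrans.congr_app hab _) x)) 1
  have h1 : (p.inverse.obj S).map (𝟙 (SingleObj.star G)) x ∈ U := of_eq_true this
  rwa [Functor.map_id_apply] at h1

theorem GeomMorphism.map_comp_app (p : GeomMorphism (SetAct.{u} G) E) {X Y Z : E} (f : X ⟶ Y)
    (g : Y ⟶ Z) (x : (p.inverse.obj X).obj (SingleObj.star G)) :
    (p.inverse.map (f ≫ g)).app _ x = (p.inverse.map g).app _ ((p.inverse.map f).app _ x) := by
  simp

/-- The inverse image of a subobject which is least among all subobjects is empty. -/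
theorem isEmpty_inverse_of_isBot [HasEqualizers E] (p : GeomMorphism (SetAct.{u} G) E) {X : E}
    {A : Subobject X} (hA : IsBot A) (x : (p.inverse.obj (A : E)).obj (SingleObj.star G)) :
    False := by
  have h : IsLUB (∅ : Set (Subobject X)) A := isLUB_empty_iff.2 hA
  obtain ⟨-, -, ⟨_, h, -⟩, -⟩ := (JointlyEpic.of_isLUB h).exists_preimage p x
  exact h

theorem GeomMorphism.mono_app (p : GeomMorphism (SetAct.{u} G) E) {A X : E} (a : A ⟶ X)
    [Mono a] : Function.Injective ((p.inverse.map a).app (SingleObj.star G)) := by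
  have := p.preservesFiniteLimits
  have : Mono (p.inverse.map a) := inferInstance
  rw [← mono_iff_injective]
  infer_instance

theorem GeomMorphism.exists_of_isPullback (p : GeomMorphism (SetAct.{u} G) E) {P X Y Z : E}
    {t : P ⟶ X} {l : P ⟶ Y} {r : X ⟶ Z} {b : Y ⟶ Z} (h : IsPullback t l r b)
    (x : (p.inverse.obj X).obj (SingleObj.star G)) (y : (p.inverse.obj Y).obj (SingleObj.star G))
    (hxy : (p.inverse.map r).app _ x = (p.inverse.map b).app _ y) :
    ∃ z, (p.inverse.map t).app _ z = x ∧ (p.inverse.map l).app _ z = y := by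
  have := p.preservesFiniteLimits
  exact Types.exists_of_isPullback ((h.map p.inverse).app (SingleObj.star G)) x y hxy

/-- For a morphism of geometric morphisms from `Set^G` to be an immersion it suffices that it
reflects membership in the inverse images of subobjects. -/
theorem isImmersion_of_reflects {p q : GeomMorphism (SetAct.{u} G) E} (η : p.inverse ⟶ q.inverse)
    (h : ∀ ⦃A X : E⦄ (a : A ⟶ X) [Mono a] (x : (p.inverse.obj X).obj (SingleObj.star G))
      (y : (q.inverse.obj A).obj (SingleObj.star G)),
      (η.app X).app _ x = (q.inverse.map a).app _ y → ∃ z, (p.inverse.map a).app _ z = x) :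
    GeomMorphism.IsImmersion η := by
  intro A X a _
  refine IsPullback.of_forall_isPullback_app fun c => ?_
  obtain rfl : c = SingleObj.star G := rfl
  rw [Types.isPullback_iff]
  have hw : ∀ z, (q.inverse.map a).app (SingleObj.star G) ((η.app A).app _ z) =
      (η.app X).app _ ((p.inverse.map a).app _ z) := fun z =>
    (ConcreteCategory.congr_hom (NatTrans.congr_app (η.naturality a) _) z).symm
  refine ⟨by ext z; exact hw z, fun z z' hz => p.mono_app a hz.2, fun y x hxy => ?_⟩
  obtain ⟨z, rfl⟩ := h a x y hxy.symm
  refine ⟨z, q.mono_app a ?_, rfl⟩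
  rw [hw, hxy]

/-- A strongly existentially closed geometric morphism is existentially closed. An element of
`p^*(X)` outside `p^*(A)`, for `A` in the basis, belongs to `p^*(¬ A)`, so that its image in
`q^*(X)` is outside `q^*(A)`; this extends to joins of basic subobjects and, by pulling back, to
subobjects of arbitrary objects. -/
theorem GeomMorphism.IsSEC.isEC [HasPullbacks E] [HasEqualizers E]
    {p : GeomMorphism (SetAct.{u} G) E} (hp : p.IsSEC) : p.IsEC := by
  obtain ⟨ι, X, B, hX, hB, hc⟩ := hp
  intro q η
  have nat : ∀ {Y Z : E} (f : Y ⟶ Z) (y : (p.inverse.obj Y).obj (SingleObj.star G)),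
      (η.app Z).app _ ((p.inverse.map f).app _ y) = (q.inverse.map f).app _ ((η.app Y).app _ y) :=
    fun f y => ConcreteCategory.congr_hom (NatTrans.congr_app (η.naturality f) _) y
  -- the case of a basic subobject
  have h₁ : ∀ i, ∀ A ∈ B i, ∀ (x : (p.inverse.obj (X i)).obj (SingleObj.star G))
      (y : (q.inverse.obj (A : E)).obj (SingleObj.star G)),
      (η.app _).app _ x = (q.inverse.map A.arrow).app _ y →
        ∃ z, (p.inverse.map A.arrow).app _ z = x := by
    intro i A hA x y hxy
    obtain ⟨N, D, hN, hD, hDi⟩ := hc i A hA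
    obtain ⟨d, rfl⟩ : ∃ d, (p.inverse.map D.arrow).app _ d = x :=
      ⟨(inv (p.inverse.map D.arrow)).app _ x,
        ConcreteCategory.congr_hom
          (NatTrans.congr_app (IsIso.inv_hom_id (p.inverse.map D.arrow)) _) x⟩
    obtain ⟨Z, t, ⟨C, hC, k, hk⟩, z, rfl⟩ := (JointlyEpic.of_isLUB hD).exists_preimage p d
    have hz : (p.inverse.map D.arrow).app _ ((p.inverse.map t).app _ z) =
        (p.inverse.map C.arrow).app _ ((p.inverse.map k).app _ z) := by
      rw [← p.map_comp_app, ← p.map_comp_app, hk]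
    rw [hz] at hxy ⊢
    obtain rfl | rfl : C = A ∨ C = N := hC
    · exact ⟨_, rfl⟩
    · rw [nat] at hxy
      obtain ⟨w, -, -⟩ := q.exists_of_isPullback (IsPullback.of_hasPullback C.arrow A.arrow) _ _ hxy
      have hbot := hN.1 (Subobject.mk (pullback.fst C.arrow A.arrow ≫ C.arrow))
        (Subobject.mk_le_of_comm (pullback.fst _ _) rfl)
        (Subobject.mk_le_of_comm (pullback.snd _ _) pullback.condition.symm)
      exact (isEmpty_inverse_of_isBot q hbot
        ((q.inverse.map (Subobject.underlyingIso _).inv).app _ w)).elim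
  -- the case of a subobject of a generator
  have h₂ : ∀ i (A : Subobject (X i)) (x : (p.inverse.obj (X i)).obj (SingleObj.star G))
      (y : (q.inverse.obj (A : E)).obj (SingleObj.star G)),
      (η.app _).app _ x = (q.inverse.map A.arrow).app _ y →
        ∃ z, (p.inverse.map A.arrow).app _ z = x := by
    intro i A x y hxy
    obtain ⟨s, hs, hA⟩ := hB i A
    obtain ⟨Z, t, ⟨C, hC, k, hk⟩, z, rfl⟩ := (JointlyEpic.of_isLUB hA).exists_preimage q y
    have hz : (q.inverse.map A.arrow).app _ ((q.inverse.map t).app _ z) =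
        (q.inverse.map C.arrow).app _ ((q.inverse.map k).app _ z) := by
      rw [← q.map_comp_app, ← q.map_comp_app, hk]
    rw [hz] at hxy
    obtain ⟨w, rfl⟩ := h₁ i C (hs hC) x _ hxy
    refine ⟨(p.inverse.map (C.ofLE A (hA.1 hC))).app _ w, ?_⟩
    rw [← p.map_comp_app, Subobject.ofLE_arrow]
  -- the general case
  refine isImmersion_of_reflects η fun A Y a _ y b hyb => ?_
  have hY : JointlyEpic (fun Z (_ : Z ⟶ Y) => ∃ i, Z = X i) := by
    intro W f g hfg
    refine hX _ _ fun Z hZ t => hfg t ?_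
    obtain ⟨i⟩ := hZ
    exact ⟨i, rfl⟩
  obtain ⟨_, t, ⟨i, rfl⟩, x, rfl⟩ := hY.exists_preimage p y
  rw [nat] at hyb
  have sq := IsPullback.of_hasPullback t a
  obtain ⟨w, hw, -⟩ := q.exists_of_isPullback sq _ _ hyb
  obtain ⟨z, rfl⟩ := h₂ i (Subobject.mk (pullback.fst t a)) x
    ((q.inverse.map (Subobject.underlyingIso _).inv).app _ w) (by
      rw [← hw, ← q.map_comp_app, Subobject.underlyingIso_arrow])
  refine ⟨(p.inverse.map ((Subobject.underlyingIso _).hom ≫ pullback.snd t a)).app _ z, ?_⟩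
  rw [← p.map_comp_app, ← p.map_comp_app, Category.assoc, ← sq.w, ← Category.assoc,
    Subobject.underlyingIso_hom_comp_eq_mk]

end JointlyEpic

variable {L : Signature.{u}}

instance Ctx.finite_var {S : Type u} : (Γ : Ctx S) → Finite Γ.Var
  | .nil => inferInstanceAs (Finite Empty)
  | .single _ => inferInstanceAs (Finite Unit)
  | .append Γ Δ =>
    have := Ctx.finite_var Γ
    have := Ctx.finite_var Δ
    inferInstanceAs (Finite (Γ.Var ⊕ Δ.Var))

/-! ### Ultraproducts of models with possibly empty sorts -/

namespace Ultraproduct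

variable {I : Type u} (U : Ultrafilter I) {T : Theory L} (N : I → T.Model)

/-- Partial sections of a sort, defined on a large set of indices. Total sections would not do:
a sort may be empty in a few of the factors. -/
def PSec (s : L.Sorts) : Type u :=
  {f : ∀ i, Option ((N i).carrier s) // ∀ᶠ i in U, ∃ x, f i = some x}

/-- Partial sections are identified if they agree on a large set of indices. -/
instance setoid (s : L.Sorts) : Setoid (PSec U N s) where
  r f g := ∀ᶠ i in U, f.1 i = g.1 i
  iseqv :=
    { refl := fun _ => .of_forall fun _ => rfl
      symm := fun h => h.mono fun _ => Eq.symm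
      trans := fun h h' => (h.and h').mono fun _ h => h.1.trans h.2 }

/-- The carriers of the ultraproduct: germs of partial sections. -/
def Carrier (s : L.Sorts) : Type u := Quotient (setoid U N s)

variable {U N}

/-- The tuple `b` of the factor at `i` is the value at `i` of (chosen representatives of) the
tuple `a` of the ultraproduct. -/
def Rep {Γ : Ctx L.Sorts} (a : ∀ v : Γ.Var, Carrier U N (Γ.sort v)) (i : I)
    (b : (N i).toStr.Tuple Γ) : Prop :=
  ∀ v, (Quotient.out (a v)).1 i = some (b v)

theorem Rep.unique {Γ : Ctx L.Sorts} {a : ∀ v : Γ.Var, Carrier U N (Γ.sort v)} {i : I}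
    {b b' : (N i).toStr.Tuple Γ} (h : Rep a i b) (h' : Rep a i b') : b = b' :=
  funext fun v => Option.some.inj ((h v).symm.trans (h' v))

theorem eventually_rep {Γ : Ctx L.Sorts} (a : ∀ v : Γ.Var, Carrier U N (Γ.sort v)) :
    ∀ᶠ i in U, ∃ b, Rep a i b := by
  have : ∀ᶠ i in U, ∀ v, ∃ x, (Quotient.out (a v)).1 i = some x :=
    Filter.eventually_all.2 fun v => (Quotient.out (a v)).2
  exact this.mono fun i h => ⟨fun v => (h v).choose, fun v => (h v).choose_spec⟩

open Classical in
/-- The germ of a family of elements, given at a large set of indices. -/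
noncomputable def germ {s : L.Sorts} (P : ∀ i, (N i).carrier s → Prop)
    (hP : ∀ᶠ i in U, ∃ x, P i x) : Carrier U N s :=
  Quotient.mk _ ⟨fun i => if h : ∃ x, P i x then some h.choose else none,
    hP.mono fun _ h => ⟨h.choose, dif_pos h⟩⟩

theorem out_germ {s : L.Sorts} (P : ∀ i, (N i).carrier s → Prop) (hP : ∀ᶠ i in U, ∃ x, P i x) :
    ∀ᶠ i in U, ∃ x, P i x ∧ (Quotient.out (germ P hP)).1 i = some x := by
  have h := Quotient.exact (Quotient.out_eq (germ P hP))
  filter_upwards [h, hP] with i hi hPi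
  exact ⟨hPi.choose, hPi.choose_spec, hi.trans (dif_pos hPi)⟩

theorem ext_of_eventually {s : L.Sorts} {x y : Carrier U N s}
    (h : ∀ᶠ i in U, (Quotient.out x).1 i = (Quotient.out y).1 i) : x = y := by
  rw [← Quotient.out_eq x, ← Quotient.out_eq y]
  exact Quotient.sound h

variable (U N)

/-- The ultraproduct as a structure. -/
noncomputable def str : Str L where
  carrier := Carrier U N
  fn f a := germ (fun i x => ∃ b, Rep a i b ∧ x = (N i).fn f b)
    ((eventually_rep a).mono fun _ ⟨b, h⟩ => ⟨_, b, h, rfl⟩)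
  rel R a := ∀ᶠ i in U, ∃ b, Rep a i b ∧ (N i).rel R b

variable {U N}

theorem rep_eval {Γ : Ctx L.Sorts} (a : (str U N).Tuple Γ) {s : L.Sorts} (t : Term L Γ s) :
    ∀ᶠ i in U, ∀ b, Rep a i b → (Quotient.out (t.eval a)).1 i = some (t.eval b) := by
  induction t with
  | var v => exact .of_forall fun i b h => h v
  | app f ts ih =>
    filter_upwards [Filter.eventually_all.2 ih, out_germ (N := N) (U := U) (s := L.cod f)
      (fun i x => ∃ b, Rep (fun v => (ts v).eval a) i b ∧ x = (N i).fn f b)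
      ((eventually_rep _).mono fun _ ⟨b, h⟩ => ⟨_, b, h, rfl⟩)] with i hi hg b hb
    obtain ⟨_, ⟨c, hc, rfl⟩, h⟩ := hg
    refine h.trans (congrArg some ?_)
    obtain rfl : c = fun v => (ts v).eval b := hc.unique fun v => hi v b hb
    rfl

theorem rep_evals {Γ Δ : Ctx L.Sorts} (a : (str U N).Tuple Γ) (ts : Subst L Δ Γ) :
    ∀ᶠ i in U, ∀ b, Rep a i b → Rep (Γ := Δ) (ts.eval a) i (ts.eval b) :=
  (Filter.eventually_all.2 fun v => rep_eval a (ts v)).mono fun _ h b hb v => h v b hb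

theorem rep_pair {Γ Δ : Ctx L.Sorts} {a : (str U N).Tuple Γ} {a' : (str U N).Tuple Δ} {i : I}
    {b : (N i).toStr.Tuple Γ} {b' : (N i).toStr.Tuple Δ} :
    Rep (Γ := Γ.append Δ) (Str.pair a a') i (Str.pair b b') ↔ Rep a i b ∧ Rep a' i b' :=
  ⟨fun h => ⟨fun v => h (Sum.inl v), fun v => h (Sum.inr v)⟩,
    fun h v => by rcases v with v | v; exacts [h.1 v, h.2 v]⟩

/-- Łoś's theorem for coherent formulas. -/
theorem holds_iff {Γ : Ctx L.Sorts} (φ : Formula L Γ) (a : (str U N).Tuple Γ) :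
    φ.Holds a ↔ ∀ᶠ i in U, ∃ b, Rep a i b ∧ φ.Holds b := by
  induction φ with
  | top =>
    exact ⟨fun _ => (eventually_rep a).mono fun _ ⟨b, h⟩ => ⟨b, h, trivial⟩, fun _ => trivial⟩
  | bot =>
    refine ⟨False.elim, fun h => ?_⟩
    obtain ⟨i, b, -, hb⟩ := h.exists
    exact hb
  | eq t t' =>
    constructor
    · intro h
      filter_upwards [rep_eval a t, rep_eval a t', eventually_rep a] with i h₁ h₂ ⟨b, hb⟩
      have h' : t.eval a = t'.eval a := h
      refine ⟨b, hb, Option.some.inj ((h₁ b hb).symm.trans ?_)⟩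
      rw [h', h₂ b hb]
    · intro h
      apply ext_of_eventually
      filter_upwards [rep_eval a t, rep_eval a t', h] with i h₁ h₂ ⟨b, hb, h⟩
      rw [h₁ b hb, h₂ b hb, show t.eval b = t'.eval b from h]
  | rel R ts =>
    constructor
    · intro h
      filter_upwards [rep_evals a ts, eventually_rep a, h] with i h₁ ⟨b, hb⟩ ⟨c, hc, h⟩
      obtain rfl := hc.unique (h₁ b hb)
      exact ⟨b, hb, h⟩
    · intro h
      change ∀ᶠ i in (U : Filter I), _
      filter_upwards [rep_evals a ts, h] with i h₁ ⟨b, hb, h⟩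
      exact ⟨_, h₁ b hb, h⟩
  | and φ ψ ihφ ihψ =>
    refine (and_congr (ihφ a) (ihψ a)).trans (Filter.eventually_and.symm.trans ?_)
    refine Filter.eventually_congr (.of_forall fun i => ⟨?_, ?_⟩)
    · rintro ⟨⟨b, hb, h⟩, b', hb', h'⟩
      obtain rfl := hb.unique hb'
      exact ⟨b, hb, h, h'⟩
    · rintro ⟨b, hb, h, h'⟩
      exact ⟨⟨b, hb, h⟩, b, hb, h'⟩
  | or φ ψ ihφ ihψ =>
    refine (or_congr (ihφ a) (ihψ a)).trans (Ultrafilter.eventually_or.symm.trans ?_)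
    refine Filter.eventually_congr (.of_forall fun i => ⟨?_, ?_⟩)
    · rintro (⟨b, hb, h⟩ | ⟨b, hb, h⟩)
      exacts [⟨b, hb, .inl h⟩, ⟨b, hb, .inr h⟩]
    · rintro ⟨b, hb, h | h⟩
      exacts [.inl ⟨b, hb, h⟩, .inr ⟨b, hb, h⟩]
  | @ex Γ Δ φ ih =>
    constructor
    · rintro ⟨c, hc⟩
      refine ((ih _).1 hc).mono fun i ⟨d, hd, h⟩ => ?_
      obtain ⟨b, b', rfl⟩ := Str.exists_pair d
      exact ⟨b, (rep_pair.1 hd).1, b', h⟩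
    · intro h
      have hP : ∀ᶠ i in U, ∃ b', ∃ b, Rep a i b ∧ φ.Holds (Str.pair b b') :=
        h.mono fun i ⟨b, hb, b', h⟩ => ⟨b', b, hb, h⟩
      -- a witness in the ultraproduct is assembled, coordinate by coordinate, from chosen ones
      let c : (str U N).Tuple Δ := fun v => germ
        (fun i x => ∃ h : ∃ b', ∃ b, Rep a i b ∧ φ.Holds (Str.pair b b'), x = h.choose v)
        (hP.mono fun i h => ⟨_, h, rfl⟩)
      have hc := Filter.eventually_all.2 fun v => out_germ (U := U) (N := N)
        (fun i x => ∃ h : ∃ b', ∃ b, Rep a i b ∧ φ.Holds (Str.pair b b'), x = h.choose v)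
        (hP.mono fun i h => ⟨_, h, rfl⟩)
      refine ⟨c, (ih _).2 ?_⟩
      filter_upwards [hc, hP] with i hi hPi
      obtain ⟨b, hb, h⟩ := hPi.choose_spec
      refine ⟨Str.pair b hPi.choose, rep_pair.2 ⟨hb, fun v => ?_⟩, h⟩
      obtain ⟨_, ⟨_, rfl⟩, h⟩ := hi v
      exact h

variable (U N)

/-- The ultraproduct of a family of models. -/
noncomputable def model : T.Model where
  toStr := str U N
  sat A hA _ h := (holds_iff _ _).2 (((holds_iff _ _).1 h).mono fun i ⟨b, hb, h⟩ =>
    ⟨b, hb, (N i).sat A hA b h⟩)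

end Ultraproduct

/-! ### Existentially closed models are strongly existentially closed -/

section Diagram

variable {T : Theory L}

/-- The correspondence between elements of `M` and `N` given by the entries of two tuples. -/
def EntryRel {M N : Str L} {Δ : Ctx L.Sorts} (c : M.Tuple Δ) (d : N.Tuple Δ) (s : L.Sorts)
    (m : M.carrier s) (n : N.carrier s) : Prop :=
  ∃ v, (⟨Δ.sort v, c v, d v⟩ : Σ s, M.carrier s × N.carrier s) = ⟨s, m, n⟩

/-- Finite conjunctions of coherent formulas. -/
theorem Formula.exists_conj {Γ : Ctx L.Sorts} {ι : Type*} [Finite ι] (ψ : ι → Formula L Γ) :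
    ∃ χ : Formula L Γ, ∀ (N : Str L) (d : N.Tuple Γ), χ.Holds d ↔ ∀ i, (ψ i).Holds d := by
  classical
  have key : ∀ s : Set ι, s.Finite → ∃ χ : Formula L Γ, ∀ (N : Str L) (d : N.Tuple Γ),
      χ.Holds d ↔ ∀ i ∈ s, (ψ i).Holds d := by
    intro s hs
    induction s, hs using Set.Finite.induction_on with
    | empty => exact ⟨.top, fun N d => by simp [Formula.Holds]⟩
    | @insert i s _ _ ih =>
      obtain ⟨χ, hχ⟩ := ih
      exact ⟨.and (ψ i) χ, fun N d => by simp [Formula.Holds, hχ]⟩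
  obtain ⟨χ, hχ⟩ := key Set.univ Set.finite_univ
  exact ⟨χ, fun N d => by simp [hχ]⟩

/-- Finitely many equations between variables express that the entries of a tuple `d` satisfy all
equalities between the entries of a given tuple `c`. -/
theorem exists_formula_functional {M : Str L} {Δ : Ctx L.Sorts} (c : M.Tuple Δ) :
    ∃ χ : Formula L Δ, χ.Holds c ∧ ∀ (N : Str L) (d : N.Tuple Δ), χ.Holds d →
      ∀ s m n n', EntryRel c d s m n → EntryRel c d s m n' → n = n' := by
  have key : ∀ {s s'} (t : Term L Δ s) (t' : Term L Δ s'), ∃ χ : Formula L Δ,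
      ∀ (N : Str L) (d : N.Tuple Δ), χ.Holds d ↔ (s = s' → HEq (t.eval d) (t'.eval d)) := by
    intro s s' t t'
    by_cases h : s = s'
    · subst h
      exact ⟨.eq t t', fun N d => by simp [Formula.Holds]⟩
    · exact ⟨.top, fun N d => by simp [Formula.Holds, h]⟩
  choose ξ hξ using fun v w : Δ.Var => key (Term.var (L := L) v) (Term.var w)
  obtain ⟨χ, hχ⟩ := Formula.exists_conj
    (fun p : {p : Δ.Var × Δ.Var // HEq (c p.1) (c p.2)} => ξ p.1.1 p.1.2)
  refine ⟨χ, (hχ _ _).2 fun p => (hξ _ _ _ _).2 fun _ => p.2, fun N d hd s m n n' => ?_⟩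
  rintro ⟨v, hv⟩ ⟨w, hw⟩
  rw [Sigma.mk.injEq] at hv hw
  obtain ⟨hs, hv⟩ := hv
  obtain ⟨hs', hw⟩ := hw
  have heq : ∀ {s s' : L.Sorts} (_ : s = s') {x : M.carrier s} {y : N.carrier s}
      {x' : M.carrier s'} {y' : N.carrier s'}, HEq (x, y) (x', y') → HEq x x' ∧ HEq y y' := by
    rintro s _ rfl x y x' y' h
    cases h
    exact ⟨.rfl, .rfl⟩
  obtain ⟨h₁, h₂⟩ := heq hs hv
  obtain ⟨h₃, h₄⟩ := heq hs' hw
  have := (hξ v w N d).1 ((hχ _ _).1 hd ⟨(v, w), h₁.trans h₃.symm⟩) (hs.trans hs'.symm)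
  exact eq_of_heq (h₂.symm.trans (HEq.trans this h₄))

/-- The facts about tuples of `M` expressed by coherent formulas: its positive diagram. -/
structure Fact (M : Str L) : Type u where
  ctx : Ctx L.Sorts
  tuple : M.Tuple ctx
  form : Formula L ctx
  holds : form.Holds tuple

/-- A relation between the elements of `M` and `N` realizes a fact about a tuple of `M` if it
relates this tuple to a tuple of `N` with the same property. -/
def Fact.RealizedBy {M N : Str L} (j : Fact M)
    (R : ∀ s, M.carrier s → N.carrier s → Prop) : Prop :=
  ∃ d : N.Tuple j.ctx, j.form.Holds d ∧ ∀ v, R _ (j.tuple v) (d v)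

/-- Finitely many facts are summarized by a single formula. -/
theorem Fact.exists_formula {M : Str L} (l : List (Fact M)) :
    ∃ (Δ : Ctx L.Sorts) (c : M.Tuple Δ) (χ : Formula L Δ), χ.Holds c ∧
      ∀ (N : Str L) (d : N.Tuple Δ), χ.Holds d → ∀ j ∈ l, j.RealizedBy (EntryRel c d) := by
  induction l with
  | nil => exact ⟨.nil, fun v => v.elim, .top, trivial, by simp⟩
  | cons k l ih =>
    obtain ⟨Δ, c, χ, hc, h⟩ := ih
    refine ⟨k.ctx.append Δ, Str.pair k.tuple c,
      .and (k.form.subst (Subst.left _ _)) (χ.subst (Subst.right _ _)), ?_, ?_⟩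
    · simp only [Formula.Holds, Formula.holds_subst, Subst.eval_left, Subst.eval_right]
      exact ⟨k.holds, hc⟩
    · intro N d hd j hj
      obtain ⟨d₁, d₂, rfl⟩ := Str.exists_pair d
      simp only [Formula.Holds, Formula.holds_subst, Subst.eval_left, Subst.eval_right] at hd
      rcases List.mem_cons.1 hj with rfl | hj
      · exact ⟨d₁, hd.1, fun v => ⟨Sum.inl v, rfl⟩⟩
      · obtain ⟨e, he, hR⟩ := h N d₂ hd.2 j hj
        refine ⟨e, he, fun v => ?_⟩
        obtain ⟨w, hw⟩ := hR v
        exact ⟨Sum.inr w, hw⟩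

/-- If `M` is existentially closed and `φ` fails at `a`, then some coherent formula true of `a` is
incompatible with `φ`. Otherwise each finite part of the positive diagram of `M` is realized by a
partial map from `M` to a model in which `φ` holds at the image of `a`; an ultraproduct of these
models is the codomain of a homomorphism from `M` that does not reflect `φ`. -/
theorem Theory.Model.IsEC.isSEC {M : T.Model} (hM : M.IsEC) : M.IsSEC := by
  classical
  intro Γ φ a ha
  by_contra! hψ
  have step : ∀ D : Finset (Fact M.toStr), ∃ (N : T.Model)
      (R : ∀ s, M.carrier s → N.carrier s → Prop), (∀ s m n n', R s m n → R s m n' → n = n') ∧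
      (∃ b : N.toStr.Tuple Γ, φ.Holds b ∧ ∀ v, R _ (a v) (b v)) ∧
      ∀ j ∈ D, j.RealizedBy R := by
    intro D
    obtain ⟨Δ, c, χ, hc, hχ⟩ := Fact.exists_formula (⟨Γ, a, .top, trivial⟩ :: D.toList)
    obtain ⟨ξ, hξc, hξ⟩ := exists_formula_functional (Str.pair a c)
    have hnot : ¬ T.Proves (.and φ (.ex Δ (.and (χ.subst (Subst.right _ _)) ξ))) .bot := by
      intro h
      refine hψ _ h ⟨c, ?_, hξc⟩
      rwa [Formula.holds_subst, Subst.eval_right]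
    unfold Theory.Proves at hnot
    push Not at hnot
    obtain ⟨N, b, ⟨hb, d, hd, hξd⟩, -⟩ := hnot
    rw [Formula.holds_subst, Subst.eval_right] at hd
    refine ⟨N, EntryRel (Str.pair a c) (Str.pair b d), hξ _ _ hξd,
      ⟨b, hb, fun v => ⟨Sum.inl v, rfl⟩⟩, fun j hj => ?_⟩
    obtain ⟨e, he, hR⟩ := hχ _ _ hd j (by simp [hj])
    refine ⟨e, he, fun v => ?_⟩
    obtain ⟨w, hw⟩ := hR v
    exact ⟨Sum.inr w, hw⟩
  choose N R hR hb hD using step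
  let U : Ultrafilter (Finset (Fact M.toStr)) := .of Filter.atTop
  have hU : ∀ j : Fact M.toStr, ∀ᶠ D in U, j.RealizedBy (R D) := fun j =>
    (Ultrafilter.of_le Filter.atTop) ((Filter.eventually_ge_atTop {j}).mono fun D h =>
      hD D j (Finset.singleton_subset_iff.1 h))
  have htot : ∀ s (m : M.carrier s), ∀ᶠ D in U, ∃ n, R D s m n := fun s m =>
    (hU ⟨.single s, fun _ => m, .top, trivial⟩).mono fun D ⟨d, _, h⟩ => ⟨d (), h ()⟩
  let e : ∀ s, M.carrier s → (Ultraproduct.model U N).carrier s := fun s m =>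
    Ultraproduct.germ (fun D n => R D s m n) (htot s m)
  -- the values of `e` at the index `D` are given by the relation `R D`
  have he : ∀ {Δ : Ctx L.Sorts} (c : M.toStr.Tuple Δ), ∀ᶠ D in U, ∀ d : (N D).toStr.Tuple Δ,
      (∀ v, R D _ (c v) (d v)) → Ultraproduct.Rep (fun v => e _ (c v)) D d := by
    intro Δ c
    refine (Filter.eventually_all.2 fun v => Ultraproduct.out_germ
      (fun D n => R D _ (c v) n) (htot _ (c v))).mono fun D h d hd v => ?_
    obtain ⟨x, hx, h⟩ := h v
    rw [hR D _ _ _ _ (hd v) hx]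
    exact h
  have hpres : ∀ j : Fact M.toStr,
      j.form.Holds (M := (Ultraproduct.model U N).toStr) fun v => e _ (j.tuple v) := by
    intro j
    refine (Ultraproduct.holds_iff _ _).2 ?_
    filter_upwards [he j.tuple, hU j] with D h ⟨d, hd, hRd⟩
    exact ⟨d, h d hRd, hd⟩
  let f : M ⟶ Ultraproduct.model U N :=
    { toFun := e
      map_fn := fun g c => by
        have h := hpres ⟨(L.dom g).append (.single (L.cod g)), Str.pair c fun _ => M.fn g c,
          .eq (.app g (Subst.left _ _)) (Subst.right (L.dom g) (.single (L.cod g)) ()), rfl⟩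
        exact h.symm
      map_rel := fun S c hc => hpres ⟨L.arity S, c, .rel S fun v => .var v, hc⟩ }
  refine ha (hM f φ a ((Ultraproduct.holds_iff _ _).2 ?_))
  filter_upwards [he a] with D h
  obtain ⟨b, hφ, hRb⟩ := hb D
  exact ⟨b, h b hRb, hφ⟩

end Diagram

/-! ### Sequential colimits of models -/

namespace SeqColimit

variable {T : Theory L} (F : ℕ ⥤ T.Model)

/-- The transition homomorphisms of a sequence of models. -/
abbrev trans {i j : ℕ} (h : i ≤ j) : F.obj i ⟶ F.obj j := F.map (homOfLE h)

theorem trans_trans {i j k : ℕ} (h : i ≤ j) (h' : j ≤ k) {s : L.Sorts} (x : (F.obj i).carrier s) :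
    (trans F h').toFun s ((trans F h).toFun s x) = (trans F (h.trans h')).toFun s x :=
  congrArg (fun f : F.obj i ⟶ F.obj k => f.toFun s x) (F.map_comp (homOfLE h) (homOfLE h')).symm

/-- Elements at two stages are identified if they have the same image at a later stage. -/
instance setoid (s : L.Sorts) : Setoid (Σ k, (F.obj k).carrier s) where
  r x y := ∃ (l : ℕ) (h : x.1 ≤ l) (h' : y.1 ≤ l),
    (trans F h).toFun s x.2 = (trans F h').toFun s y.2
  iseqv :=
    { refl := fun x => ⟨x.1, le_rfl, le_rfl, rfl⟩
      symm := fun ⟨l, h, h', e⟩ => ⟨l, h', h, e.symm⟩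
      trans := by
        rintro x y z ⟨l, h₁, h₂, e⟩ ⟨m, h₃, h₄, e'⟩
        refine ⟨max l m, h₁.trans (le_max_left _ _), h₄.trans (le_max_right _ _), ?_⟩
        have e₁ := congrArg ((trans F (le_max_left l m)).toFun s) e
        have e₂ := congrArg ((trans F (le_max_right l m)).toFun s) e'
        rw [trans_trans, trans_trans] at e₁ e₂
        exact e₁.trans e₂ }

/-- The carriers of the colimit. -/
def Carrier (s : L.Sorts) : Type u := Quotient (setoid F s)

variable {F}

/-- The tuple of the colimit represented by a tuple of the model at stage `k`. -/
def incl (k : ℕ) {Γ : Ctx L.Sorts} (b : (F.obj k).toStr.Tuple Γ) (v : Γ.Var) :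
    Carrier F (Γ.sort v) :=
  Quotient.mk (setoid F _) ⟨k, b v⟩

theorem incl_trans {k l : ℕ} (h : k ≤ l) {Γ : Ctx L.Sorts} (b : (F.obj k).toStr.Tuple Γ) :
    incl l (Str.Hom.onTuple (trans F h) b) = incl k b :=
  funext fun _ => Quotient.sound ⟨l, le_rfl, h, trans_trans F h le_rfl _⟩

/-- Tuples being finite, each tuple of the colimit comes from some stage. -/
theorem exists_incl {Γ : Ctx L.Sorts} (a : ∀ v : Γ.Var, Carrier F (Γ.sort v)) :
    ∃ (k : ℕ) (b : (F.obj k).toStr.Tuple Γ), incl k b = a := by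
  choose x hx using fun v => Quotient.exists_rep (a v)
  obtain ⟨k, hk⟩ := (Set.finite_range fun v => (x v).1).bddAbove
  have hk' : ∀ v, (x v).1 ≤ k := fun v => hk ⟨v, rfl⟩
  refine ⟨k, fun v => (trans F (hk' v)).toFun _ (x v).2, funext fun v => ?_⟩
  refine Eq.trans (Quotient.sound ?_) (hx v)
  exact ⟨k, le_rfl, hk' v, trans_trans F _ le_rfl _⟩

theorem exists_of_incl_eq {k l : ℕ} {Γ : Ctx L.Sorts} {b : (F.obj k).toStr.Tuple Γ}
    {c : (F.obj l).toStr.Tuple Γ} (h : incl k b = incl l c) :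
    ∃ (m : ℕ) (h₁ : k ≤ m) (h₂ : l ≤ m),
      Str.Hom.onTuple (trans F h₁) b = Str.Hom.onTuple (trans F h₂) c := by
  choose m h₁ h₂ e using fun v => Quotient.exact (congrFun h v)
  obtain ⟨n, hn⟩ := (Set.finite_range m).bddAbove
  have hn' : ∀ v, m v ≤ max n (max k l) := fun v => (hn ⟨v, rfl⟩).trans (le_max_left _ _)
  refine ⟨max n (max k l), by simp, by simp, funext fun v => ?_⟩
  have := congrArg ((trans F (hn' v)).toFun _) (e v)
  rwa [trans_trans, trans_trans] at this

variable (F)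

/-- The colimit as a structure. -/
noncomputable def str : Str L where
  carrier := Carrier F
  fn f a := Quotient.mk (setoid F _)
    ⟨(exists_incl a).choose, (F.obj _).fn f (exists_incl a).choose_spec.choose⟩
  rel R a := ∃ (k : ℕ) (b : (F.obj k).toStr.Tuple (L.arity R)), incl k b = a ∧ (F.obj k).rel R b

variable {F}

theorem fn_incl (f : L.Fn) {k : ℕ} (b : (F.obj k).toStr.Tuple (L.dom f)) :
    (str F).fn f (incl k b) = Quotient.mk (setoid F _) ⟨k, (F.obj k).fn f b⟩ := by
  have h := exists_incl (F := F) (incl k b)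
  obtain ⟨m, h₁, h₂, e⟩ := exists_of_incl_eq h.choose_spec.choose_spec
  refine Quotient.sound ⟨m, h₁, h₂, ?_⟩
  rw [(trans F h₁).map_fn, (trans F h₂).map_fn]
  exact congrArg ((F.obj m).fn f) e

theorem eval_incl {Γ : Ctx L.Sorts} {k : ℕ} (b : (F.obj k).toStr.Tuple Γ) {s : L.Sorts}
    (t : Term L Γ s) :
    t.eval (M := str F) (incl k b) = Quotient.mk (setoid F s) ⟨k, t.eval b⟩ := by
  induction t with
  | var v => rfl
  | app f ts ih =>
    refine Eq.trans (congrArg ((str F).fn f) (funext fun v => ih v)) ?_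
    exact fn_incl f fun v => (ts v).eval b

theorem incl_pair {Γ Δ : Ctx L.Sorts} {k : ℕ} (b : (F.obj k).toStr.Tuple Γ)
    (c : (F.obj k).toStr.Tuple Δ) :
    incl k (Str.pair b c) = Str.pair (M := str F) (incl k b) (incl k c) := by
  funext v; rcases v with v | v <;> rfl

/-- A coherent formula holds in the colimit if and only if it holds at some stage. -/
theorem holds_iff {Γ : Ctx L.Sorts} (φ : Formula L Γ) (a : (str F).Tuple Γ) :
    φ.Holds a ↔ ∃ (k : ℕ) (b : (F.obj k).toStr.Tuple Γ), incl k b = a ∧ φ.Holds b := by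
  induction φ with
  | top =>
    refine ⟨fun _ => ?_, fun _ => trivial⟩
    obtain ⟨k, b, h⟩ := exists_incl a
    exact ⟨k, b, h, trivial⟩
  | bot => exact ⟨False.elim, fun ⟨_, _, _, h⟩ => h⟩
  | eq t t' =>
    constructor
    · intro h
      obtain ⟨k, b, rfl⟩ := exists_incl a
      change t.eval _ = t'.eval _ at h
      rw [eval_incl, eval_incl] at h
      obtain ⟨m, h₁, _, e⟩ := Quotient.exact h
      refine ⟨m, _, incl_trans h₁ b, ?_⟩
      change t.eval _ = t'.eval _
      rw [← (trans F h₁).map_eval, ← (trans F h₁).map_eval]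
      exact e
    · rintro ⟨k, b, rfl, h⟩
      change t.eval _ = t'.eval _
      rw [eval_incl, eval_incl, show t.eval b = t'.eval b from h]
  | rel R ts =>
    have hts : ∀ {k : ℕ} (b : (F.obj k).toStr.Tuple _),
        (fun v => (ts v).eval (M := str F) (incl k b)) = incl k fun v => (ts v).eval b :=
      fun b => funext fun v => eval_incl b (ts v)
    constructor
    · rintro ⟨l, c, hc, h⟩
      obtain ⟨k, b, rfl⟩ := exists_incl a
      rw [hts] at hc
      obtain ⟨m, h₁, h₂, e⟩ := exists_of_incl_eq hc
      refine ⟨m, _, incl_trans h₂ b, ?_⟩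
      have := (trans F h₁).map_rel R c h
      change (F.obj m).rel R (Str.Hom.onTuple (trans F h₁) c) at this
      rw [e] at this
      change (F.obj m).rel R _
      convert this using 2 with v
      exact ((trans F h₂).map_eval b (ts v)).symm
    · rintro ⟨k, b, rfl, h⟩
      exact ⟨k, _, (hts b).symm, h⟩
  | and φ ψ ihφ ihψ =>
    refine (and_congr (ihφ a) (ihψ a)).trans ⟨?_, ?_⟩
    · rintro ⟨⟨k, b, rfl, h⟩, l, c, hc, h'⟩
      obtain ⟨m, h₁, h₂, e⟩ := exists_of_incl_eq hc
      refine ⟨m, _, incl_trans h₂ b, Str.Hom.map_holds (trans F h₂) φ b h, ?_⟩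
      rw [← e]
      exact Str.Hom.map_holds (trans F h₁) ψ c h'
    · rintro ⟨k, b, hb, h, h'⟩
      exact ⟨⟨k, b, hb, h⟩, k, b, hb, h'⟩
  | or φ ψ ihφ ihψ =>
    refine (or_congr (ihφ a) (ihψ a)).trans ⟨?_, ?_⟩
    · rintro (⟨k, b, hb, h⟩ | ⟨k, b, hb, h⟩)
      exacts [⟨k, b, hb, .inl h⟩, ⟨k, b, hb, .inr h⟩]
    · rintro ⟨k, b, hb, h | h⟩
      exacts [.inl ⟨k, b, hb, h⟩, .inr ⟨k, b, hb, h⟩]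
  | ex Δ φ ih =>
    constructor
    · rintro ⟨c, hc⟩
      obtain ⟨k, d, hd, h⟩ := (ih _).1 hc
      obtain ⟨b, b', rfl⟩ := Str.exists_pair d
      rw [incl_pair] at hd
      exact ⟨k, b, funext fun v => congrFun hd (Sum.inl v), b', h⟩
    · rintro ⟨k, b, rfl, b', h⟩
      exact ⟨incl k b', (ih _).2 ⟨k, _, incl_pair b b', h⟩⟩

variable (F)

/-- The colimit of a sequence of models. -/
noncomputable def model : T.Model where
  toStr := str F
  sat A hA a h := by
    obtain ⟨k, b, hb, h⟩ := (holds_iff _ _).1 h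
    exact (holds_iff _ _).2 ⟨k, b, hb, (F.obj k).sat A hA b h⟩

/-- The colimit cocone of a sequence of models. -/
noncomputable def cocone : Cocone F where
  pt := model F
  ι :=
    { app := fun k =>
        { toFun := fun s x => Quotient.mk (setoid F s) ⟨k, x⟩
          map_fn := fun f b => (fn_incl f b).symm
          map_rel := fun _ b h => ⟨k, b, rfl, h⟩ }
      naturality := fun k l h => by
        refine Str.Hom.ext (funext fun s => funext fun x => ?_)
        exact Quotient.sound ⟨l, le_rfl, leOfHom h, trans_trans F (leOfHom h) le_rfl x⟩ }

theorem desc_incl (c : Cocone F) {k l : ℕ} (h : k ≤ l) {s : L.Sorts} (x : (F.obj k).carrier s) :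
    (c.ι.app l).toFun s ((trans F h).toFun s x) = (c.ι.app k).toFun s x :=
  congrArg (fun f : F.obj k ⟶ c.pt => f.toFun s x) (c.w (homOfLE h))

/-- The homomorphism out of the colimit given by a cocone. -/
noncomputable def desc (c : Cocone F) : model F ⟶ c.pt where
  toFun s := Quotient.lift (fun x : Σ k, (F.obj k).carrier s => (c.ι.app x.1).toFun s x.2) (by
    rintro x y ⟨l, h, h', e⟩
    have := congrArg ((c.ι.app l).toFun s) e
    rwa [desc_incl, desc_incl] at this)
  map_fn f a := by
    obtain ⟨k, b, rfl⟩ := exists_incl a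
    refine Eq.trans (congrArg _ (fn_incl f b)) ?_
    exact (c.ι.app k).map_fn f b
  map_rel R a := by
    rintro ⟨k, b, rfl, h⟩
    exact (c.ι.app k).map_rel R b h

/-- The colimit cocone is a colimit. -/
noncomputable def isColimit : IsColimit (cocone F) where
  desc := desc F
  fac c k := rfl
  uniq c m hm := by
    refine Str.Hom.ext (funext fun s => funext fun x => ?_)
    induction x using Quotient.inductionOn with
    | h x => exact congrArg (fun f : F.obj x.1 ⟶ c.pt => f.toFun s x.2) (hm x.1)

instance : HasColimitsOfShape ℕ T.Model := ⟨fun F => ⟨⟨⟨cocone F, isColimit F⟩⟩⟩⟩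

end SeqColimit

/-! ### Extending homomorphisms to equivariant ones -/

section Equivariant

variable {C : Type u₁} [Category.{v₁} C]

/-- Two parallel morphisms. -/
structure ParallelPair (C : Type u₁) [Category.{v₁} C] where
  src : C
  tgt : C
  fst : src ⟶ tgt
  snd : src ⟶ tgt

theorem exists_colimit_of_sequence [HasColimitsOfShape ℕ C] (X : ℕ → C)
    (g : ∀ n, X n ⟶ X (n + 1)) :
    ∃ (Y : C) (ι : ∀ n, X n ⟶ Y), (∀ n, g n ≫ ι (n + 1) = ι n) ∧
      (∀ (Z : C) (c : ∀ n, X n ⟶ Z), (∀ n, g n ≫ c (n + 1) = c n) →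
        ∃ d : Y ⟶ Z, ∀ n, ι n ≫ d = c n) ∧
      ∀ (Z : C) (d e : Y ⟶ Z), (∀ n, ι n ≫ d = ι n ≫ e) → d = e := by
  have hg : ∀ n, (Functor.ofSequence g).map (homOfLE (Nat.le_add_right n 1)) = g n :=
    Functor.ofSequence_map_homOfLE_succ g
  refine ⟨colimit (Functor.ofSequence g), fun n => colimit.ι (Functor.ofSequence g) n,
    fun n => ?_, fun Z c hc => ?_, fun Z d e h => colimit.hom_ext h⟩
  · exact Eq.trans (congrArg (· ≫ colimit.ι (Functor.ofSequence g) (n + 1)) (hg n).symm)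
      (colimit.w (Functor.ofSequence g) (homOfLE (Nat.le_add_right n 1)))
  · let c' : Functor.ofSequence g ⟶ (Functor.const ℕ).obj Z :=
      NatTrans.ofSequence c fun n => by
        rw [hg]
        exact (hc n).trans (Category.comp_id _).symm
    exact ⟨colimit.desc _ ⟨Z, c'⟩, fun n => colimit.ι_desc _ _⟩

/-- In a category with amalgamation and sequential colimits, an object over `(M, σ)` can be
enlarged to one with an endomorphism compatible with `σ`. Amalgamation produces a sequence
`M = X₀ ⟶ X₁ = N ⟶ X₂ ⟶ ⋯` together with morphisms `tₖ : Xₖ ⟶ Xₖ₊₁` commuting with the transition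
morphisms, where `t₀ = σ ≫ f`; the colimit of the `tₖ` is the endomorphism. -/
theorem exists_equivariant_endomorphism [HasColimitsOfShape ℕ C]
    (hC : ∀ ⦃X Y Z : C⦄ (f : X ⟶ Y) (g : X ⟶ Z),
      ∃ (W : C) (f' : Y ⟶ W) (g' : Z ⟶ W), f ≫ f' = g ≫ g')
    {M N : C} (σ : M ⟶ M) (f : M ⟶ N) :
    ∃ (N' : C) (k : N ⟶ N') (τ : N' ⟶ N'), σ ≫ f ≫ k = f ≫ k ≫ τ := by
  have key : ∀ (X : ℕ → C) (g t : ∀ n, X n ⟶ X (n + 1)),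
      (∀ n, g n ≫ t (n + 1) = t n ≫ g (n + 1)) →
        ∃ (Y : C) (k : X 1 ⟶ Y) (τ : Y ⟶ Y), t 0 ≫ k = g 0 ≫ k ≫ τ := by
    intro X g t hgt
    obtain ⟨Y, ι, hι, hdesc, -⟩ := exists_colimit_of_sequence X g
    obtain ⟨τ, hτ⟩ := hdesc Y (fun n => t n ≫ ι (n + 1)) fun n => by
      rw [← Category.assoc, hgt, Category.assoc, hι]
    have h₀ := hgt 0
    have h₁ := hι 1
    refine ⟨Y, ι 1, τ, ?_⟩
    rw [hτ, ← Category.assoc, h₀, Category.assoc, h₁]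
  choose W t' g' h using hC
  let S : ℕ → ParallelPair C := fun n => n.rec ⟨M, N, f, σ ≫ f⟩ fun _ p =>
    ⟨p.tgt, W p.fst p.snd, g' p.fst p.snd, t' p.fst p.snd⟩
  let X : ℕ → C := fun n => (S n).src
  let g : ∀ n, X n ⟶ X (n + 1) := fun n => (S n).fst
  let t : ∀ n, X n ⟶ X (n + 1) := fun n => (S n).snd
  have hgt : ∀ n, g n ≫ t (n + 1) = t n ≫ g (n + 1) := fun n => h (S n).fst (S n).snd
  obtain ⟨Y, k, τ, hτ⟩ := key X g t hgt
  exact ⟨Y, k, τ, (Category.assoc σ f k).symm.trans hτ⟩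

/-- An endomorphism can be enlarged to an automorphism: take the colimit of its iteration. -/
theorem exists_equivariant_automorphism [HasColimitsOfShape ℕ C] {N : C} (τ : N ⟶ N) :
    ∃ (N' : C) (k : N ⟶ N') (ρ : N' ≅ N'), τ ≫ k = k ≫ ρ.hom := by
  obtain ⟨Y, ι, hι, hdesc, hext⟩ := exists_colimit_of_sequence (fun _ => N) fun _ => τ
  obtain ⟨c, hc⟩ := hdesc Y (fun n => τ ≫ ι n) fun n => by rw [hι]
  obtain ⟨d, hd⟩ := hdesc Y (fun n => ι (n + 1)) fun n => hι (n + 1)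
  refine ⟨Y, ι 0, ⟨c, d, hext _ _ _ fun n => ?_, hext _ _ _ fun n => ?_⟩, (hc 0).symm⟩
  · rw [← Category.assoc, hc, Category.assoc, hd, hι, Category.comp_id]
  · rw [← Category.assoc, hd, hc, hι, Category.comp_id]

/-- A morphism that commutes with given endomorphisms is a morphism of the corresponding functors
on the monoid `ℕ`. -/
theorem comp_powersHom {M N : C} {σ : End M} {τ : End N} {f : M ⟶ N} (h : σ ≫ f = f ≫ τ)
    (n : Multiplicative ℕ) :
    (powersHom (End M) σ n : M ⟶ M) ≫ f = f ≫ (powersHom (End N) τ n : N ⟶ N) := by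
  rw [powersHom_apply, powersHom_apply]
  induction n.toAdd with
  | zero => exact (Category.id_comp f).trans (Category.comp_id f).symm
  | succ n ih =>
    rw [pow_succ, pow_succ, End.mul_def, End.mul_def, Category.assoc, ih, ← Category.assoc, h,
      Category.assoc]

theorem comp_zpowersHom {M N : C} {σ : Aut M} {τ : Aut N} {f : M ⟶ N}
    (h : σ.hom ≫ f = f ≫ τ.hom) (n : Multiplicative ℤ) :
    (zpowersHom (Aut M) σ n).hom ≫ f = f ≫ (zpowersHom (Aut N) τ n).hom := by
  have h' : σ.inv ≫ f = f ≫ τ.inv := by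
    exact (Iso.inv_comp_eq (show M ≅ M from σ)).2 (by
      rw [← Category.assoc]
      exact ((Iso.eq_comp_inv (show N ≅ N from τ)).2 h.symm))
  rw [zpowersHom_apply, zpowersHom_apply]
  induction n.toAdd using Int.induction_on with
  | zero => exact (Category.id_comp f).trans (Category.comp_id f).symm
  | succ n ih =>
    rw [zpow_add_one, zpow_add_one]
    change (σ.hom ≫ (σ ^ (n : ℤ)).hom) ≫ f = f ≫ τ.hom ≫ (τ ^ (n : ℤ)).hom
    rw [Category.assoc, ih, ← Category.assoc, h, Category.assoc]
  | pred n ih =>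
    rw [zpow_sub_one, zpow_sub_one]
    change (σ.inv ≫ (σ ^ (-n : ℤ)).hom) ≫ f = f ≫ τ.inv ≫ (τ ^ (-n : ℤ)).hom
    rw [Category.assoc, ih, ← Category.assoc, h', Category.assoc]

end Equivariant

/-! ### Constructions in the syntactic category -/

namespace SynCat

variable {T : Theory L}

/-- The morphism given by a functional formula. -/
def ofForm {X Y : SynCat T} (θ : FunForm X Y) : X ⟶ Y := Quotient.mk (funSetoid X Y) θ

theorem exists_ofForm {X Y : SynCat T} (f : X ⟶ Y) : ∃ θ : FunForm X Y, ofForm θ = f :=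
  Quotient.exists_rep f

theorem fn_ofForm {X Y : SynCat T} (θ : FunForm X Y) (M : T.Model) (a : X.Interp M) :
    θ.1.Holds (Str.pair a.1 (Mor.fn (ofForm θ) M a).1) :=
  Mor.graph_fn (ofForm θ) M a

theorem fn_ofForm_eq {X Y : SynCat T} (θ : FunForm X Y) (M : T.Model) (a : X.Interp M)
    (b : Y.Interp M) (h : θ.1.Holds (Str.pair a.1 b.1)) : Mor.fn (ofForm θ) M a = b :=
  Mor.fn_eq (ofForm θ) M a b h

theorem Mor.ext_fn {X Y : SynCat T} {f g : X ⟶ Y}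
    (h : ∀ (M : T.Model) (a : X.Interp M), Mor.fn f M a = Mor.fn g M a) : f = g := by
  have key : ∀ {f g : X ⟶ Y}, (∀ (M : T.Model) (a : X.Interp M), Mor.fn f M a = Mor.fn g M a) →
      ∀ (M : T.Model) a b, Mor.Graph f M a b → Mor.Graph g M a b := by
    intro f g h M a b hab
    have ha := Mor.graph_holds f hab
    have e := (h M ⟨a, ha.1⟩).symm.trans (Mor.fn_eq f M ⟨a, ha.1⟩ ⟨b, ha.2⟩ hab)
    exact (congrArg (fun c : Y.Interp M => Mor.Graph g M a c.1) e).mp (Mor.graph_fn g M ⟨a, ha.1⟩)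
  exact Mor.ext fun M a b => ⟨key h M a b, key (fun M a => (h M a).symm) M a b⟩

/-- The morphism given by a tuple of terms. -/
def ofTerms {X Y : SynCat T} (τ : Subst L Y.ctx X.ctx)
    (h : ∀ (M : T.Model) (a : M.toStr.Tuple X.ctx), X.form.Holds a → Y.form.Holds (τ.eval a)) :
    X ⟶ Y :=
  ofForm (termForm τ h)

theorem fn_ofTerms {X Y : SynCat T} (τ : Subst L Y.ctx X.ctx)
    (h : ∀ (M : T.Model) (a : M.toStr.Tuple X.ctx), X.form.Holds a → Y.form.Holds (τ.eval a))
    (M : T.Model) (a : X.Interp M) : Mor.fn (ofTerms τ h) M a = ⟨τ.eval a.1, h M _ a.2⟩ :=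
  Mor.fn_eq _ _ _ _ ((graph_termForm τ h M _ _).2 ⟨a.2, rfl⟩)

/-- The subobject `{x . χ ∧ φ}` of `{x . χ}`. -/
def sub (X : SynCat T) (φ : Formula L X.ctx) : SynCat T := ⟨X.ctx, .and X.form φ⟩

/-- The inclusion of `{x . χ ∧ φ}` in `{x . χ}`. -/
def subι (X : SynCat T) (φ : Formula L X.ctx) : X.sub φ ⟶ X :=
  ofTerms (X := X.sub φ) (fun v => .var v) fun _ _ h => h.1

theorem fn_subι (X : SynCat T) (φ : Formula L X.ctx) (M : T.Model) (a : (X.sub φ).Interp M) :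
    Mor.fn (X.subι φ) M a = ⟨a.1, a.2.1⟩ :=
  fn_ofTerms _ _ _ _

instance (X : SynCat T) (φ : Formula L X.ctx) : Mono (X.subι φ) where
  right_cancellation f g h := Mor.ext_fn fun M a => by
    have := congrArg (fun k => Mor.fn k M a) h
    simp only [Mor.fn_comp, fn_subι] at this
    exact Subtype.ext (congrArg (fun b => b.1) this)

/-- A morphism whose values satisfy `φ` in all models factors through the subobject defined by
`φ`. -/
theorem exists_lift_sub {X Z : SynCat T} (φ : Formula L X.ctx) (g : Z ⟶ X)
    (hg : ∀ (M : T.Model) (b : Z.Interp M), φ.Holds (Mor.fn g M b).1) :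
    ∃ e : Z ⟶ X.sub φ, e ≫ X.subι φ = g := by
  obtain ⟨θ, rfl⟩ := exists_ofForm g
  have hθ : ∀ (M : T.Model) (a : M.toStr.Tuple Z.ctx) (b : M.toStr.Tuple X.ctx),
      θ.1.Holds (Str.pair a b) → φ.Holds b := by
    intro M a b h
    have h' := (θ.2 M).1 a b h
    have := hg M ⟨a, h'.1⟩
    rwa [fn_ofForm_eq θ M ⟨a, h'.1⟩ ⟨b, h'.2⟩ h] at this
  let θ' : FunForm Z (X.sub φ) :=
    ⟨θ.1, fun M => ⟨fun a b h => ⟨((θ.2 M).1 a b h).1, ((θ.2 M).1 a b h).2, hθ M a b h⟩,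
      (θ.2 M).2⟩⟩
  refine ⟨ofForm θ', Mor.ext_fn fun M a => ?_⟩
  rw [Mor.fn_comp, fn_subι]
  exact (fn_ofForm_eq θ M a _ (fn_ofForm θ' M a)).symm

/-- The image of a morphism is defined by a coherent formula. -/
theorem exists_image_formula {X Z : SynCat T} (g : Z ⟶ X) :
    ∃ φ : Formula L X.ctx, ∀ (M : T.Model) (a : M.toStr.Tuple X.ctx),
      φ.Holds a ↔ ∃ b : Z.Interp M, (Mor.fn g M b).1 = a := by
  obtain ⟨θ, rfl⟩ := exists_ofForm g
  refine ⟨.ex Z.ctx (θ.1.subst (Subst.pair (Subst.right X.ctx Z.ctx) (Subst.left X.ctx Z.ctx))),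
    fun M a => ?_⟩
  simp only [Formula.Holds, Formula.holds_subst, Subst.eval_pair, Subst.eval_left,
    Subst.eval_right]
  constructor
  · rintro ⟨b, h⟩
    have h' := (θ.2 M).1 b a h
    exact ⟨⟨b, h'.1⟩, congrArg Subtype.val (fn_ofForm_eq θ M ⟨b, h'.1⟩ ⟨a, h'.2⟩ h)⟩
  · rintro ⟨b, rfl⟩
    exact ⟨b.1, fn_ofForm θ M b⟩

/-- Weak products in the syntactic category, computed as in models. -/
theorem exists_prod (X Y : SynCat T) :
    ∃ (P : SynCat T) (p : P ⟶ X) (q : P ⟶ Y), ∀ (M : T.Model) (a : X.Interp M) (b : Y.Interp M),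
      ∃ c : P.Interp M, Mor.fn p M c = a ∧ Mor.fn q M c = b := by
  let P : SynCat T := ⟨X.ctx.append Y.ctx,
    .and (X.form.subst (Subst.left X.ctx Y.ctx)) (Y.form.subst (Subst.right X.ctx Y.ctx))⟩
  have hX : ∀ (M : T.Model) (c : M.toStr.Tuple P.ctx), P.form.Holds c →
      X.form.Holds ((Subst.left X.ctx Y.ctx : Subst L X.ctx P.ctx).eval c) :=
    fun M c h => (Formula.holds_subst _ _ _).1 h.1
  have hY : ∀ (M : T.Model) (c : M.toStr.Tuple P.ctx), P.form.Holds c →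
      Y.form.Holds ((Subst.right X.ctx Y.ctx : Subst L Y.ctx P.ctx).eval c) :=
    fun M c h => (Formula.holds_subst _ _ _).1 h.2
  refine ⟨P, ofTerms _ hX, ofTerms _ hY, fun M a b =>
    ⟨⟨Str.pair (Γ := X.ctx) (Δ := Y.ctx) a.1 b.1, ?_, ?_⟩, ?_, ?_⟩⟩
  · exact (Formula.holds_subst _ _ _).2 a.2
  · exact (Formula.holds_subst _ _ _).2 b.2
  · exact fn_ofTerms _ hX _ _
  · exact fn_ofTerms _ hY _ _

/-- Weak equalizers in the syntactic category, computed as in models. -/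
theorem exists_equalizer {X Y : SynCat T} (f g : X ⟶ Y) :
    ∃ φ : Formula L X.ctx, X.subι φ ≫ f = X.subι φ ≫ g ∧
      ∀ (M : T.Model) (a : X.Interp M), Mor.fn f M a = Mor.fn g M a → φ.Holds a.1 := by
  obtain ⟨θ, rfl⟩ := exists_ofForm f
  obtain ⟨θ', rfl⟩ := exists_ofForm g
  refine ⟨.ex Y.ctx (.and θ.1 θ'.1), Mor.ext_fn fun M a => ?_, fun M a h => ?_⟩
  · rw [Mor.fn_comp, Mor.fn_comp, fn_subι]
    obtain ⟨b, h, h'⟩ := a.2.2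
    have hb := ((θ.2 M).1 _ _ h).2
    exact (fn_ofForm_eq θ M ⟨a.1, a.2.1⟩ ⟨b, hb⟩ h).trans
      (fn_ofForm_eq θ' M ⟨a.1, a.2.1⟩ ⟨b, hb⟩ h').symm
  · have h₂ := fn_ofForm θ' M a
    rw [← h] at h₂
    exact ⟨_, fn_ofForm θ M a, h₂⟩

end SynCat

/-! ### Models as points of the syntactic site -/

section Point

variable {T : Theory L}

/-- The interpretation of formulas in a model is a flat functor. -/
theorem isCofiltered_elements (M : T.Model) : IsCofiltered (T.interp.obj M).Elements where
  nonempty := ⟨(T.interp.obj M).elementsMk ⟨.nil, .top⟩ ⟨fun v => v.elim, trivial⟩⟩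
  cone_objs := by
    rintro ⟨X, a⟩ ⟨Y, b⟩
    obtain ⟨P, p, q, h⟩ := SynCat.exists_prod X Y
    obtain ⟨c, hp, hq⟩ := h M a b
    exact ⟨(T.interp.obj M).elementsMk P c, ⟨p, hp⟩, ⟨q, hq⟩, trivial⟩
  cone_maps := by
    rintro ⟨X, a⟩ ⟨Y, b⟩ ⟨f, hf⟩ ⟨g, hg⟩
    obtain ⟨φ, hφ, h⟩ := SynCat.exists_equalizer f g
    refine ⟨(T.interp.obj M).elementsMk (X.sub φ) ⟨a.1, a.2, h M a (hf.trans hg.symm)⟩,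
      ⟨X.subι φ, SynCat.fn_subι _ _ _ _⟩, Subtype.ext hφ⟩

/-- The point of the syntactic site given by a model of `T` in `Set`. -/
noncomputable def Theory.Model.point (M : T.Model) : GrothendieckTopology.Point.{u} T.topology where
  fiber := T.interp.obj M
  isCofiltered := isCofiltered_elements M
  initiallySmall := initiallySmall_of_essentiallySmall _
  jointly_surjective := by
    rintro X R ⟨l, hl, hcov⟩ a
    obtain ⟨g, hg, b, hb⟩ := hcov M a
    exact ⟨g.1, g.2, hl g hg, b, hb⟩

/-- A homomorphism of models induces a morphism of points, in the opposite direction. -/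
noncomputable def pointMap {M N : T.Model} (h : M ⟶ N) : N.point ⟶ M.point := ⟨T.interp.map h⟩

/-- The fibers of presheaves on the syntactic category at the points given by models. -/
noncomputable def presheafFiber (T : Theory L) :
    T.Model ⥤ ((SynCat T)ᵒᵖ ⥤ Type u) ⥤ Type u where
  obj M := M.point.presheafFiber
  map h := (pointMap h).presheafFiber
  map_id M := by
    have : pointMap (𝟙 M) = 𝟙 _ := GrothendieckTopology.Point.hom_ext (T.interp.map_id M)
    rw [this]
    exact GrothendieckTopology.Point.Hom.presheafFiber_id _
  map_comp f g := by
    have : pointMap (f ≫ g) = pointMap g ≫ pointMap f :=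
      GrothendieckTopology.Point.hom_ext (T.interp.map_comp f g)
    rw [this]
    exact GrothendieckTopology.Point.Hom.presheafFiber_comp _ _

variable {G : Type} [Monoid G] (A : SingleObj G ⥤ T.Model)

/-- The inverse image functor on presheaves: the fiber at the model underlying `A`, on which `G`
acts by functoriality of the fiber in the model. -/
noncomputable def presheafInverse : ((SynCat T)ᵒᵖ ⥤ Type u) ⥤ SetAct.{u} G :=
  (A ⋙ presheafFiber T).flip

instance : PreservesColimitsOfSize.{u, u} (presheafInverse A) :=
  preservesColimits_of_evaluation _ fun k =>
    inferInstanceAs (PreservesColimitsOfSize.{u, u} (A.obj k).point.presheafFiber)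

instance : PreservesFiniteLimits (presheafInverse A) :=
  preservesFiniteLimits_of_evaluation _ fun k =>
    inferInstanceAs (PreservesFiniteLimits (A.obj k).point.presheafFiber)

theorem isInvertedBy_presheafInverse : T.topology.W.IsInvertedBy (presheafInverse A) := by
  intro P Q f hf
  have : ∀ k, IsIso (((presheafInverse A).map f).app k) := fun k =>
    (A.obj k).point.W_isInvertedBy_presheafFiber f hf
  exact NatIso.isIso_of_isIso_app _

instance isLeftKanExtension_of_preservesColimits {C : Type u} [SmallCategory C]
    (F : (Cᵒᵖ ⥤ Type u) ⥤ SetAct.{u} G) [PreservesColimitsOfSize.{u, u} F] :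
    F.IsLeftKanExtension (𝟙 (uliftYoneda.{u} ⋙ F)) :=
  Presheaf.isLeftKanExtension_of_preservesColimits.{u, u, u, u, u + 1} F
    (Iso.refl (uliftYoneda.{u} ⋙ F))

instance : (presheafInverse A).IsLeftAdjoint :=
  (Presheaf.uliftYonedaAdjunction.{u, u, u, u, u + 1} (presheafInverse A)
    (𝟙 (uliftYoneda.{u} ⋙ presheafInverse A))).isLeftAdjoint

/-- The right adjoint of a functor on presheaves that inverts the local isomorphisms takes values
in sheaves. -/
theorem isSheaf_of_adjunction {C : Type u₁} [Category.{v₁} C] {J : GrothendieckTopology C}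
    [HasWeakSheafify J (Type u)] {D : Type u₂} [Category.{v₂} D] {F : (Cᵒᵖ ⥤ Type u) ⥤ D}
    {R : D ⥤ Cᵒᵖ ⥤ Type u} (adj : F ⊣ R) (hF : J.W.IsInvertedBy F) (W : D) :
    Presheaf.IsSheaf J (R.obj W) := by
  have := hF _ (J.W_toSheafify (R.obj W))
  -- the unit of sheafification has a retraction, hence is invertible
  let r : sheafify J (R.obj W) ⟶ R.obj W :=
    adj.homEquiv _ _ (inv (F.map (toSheafify J (R.obj W))) ≫ (adj.homEquiv _ _).symm (𝟙 _))
  have hr : toSheafify J (R.obj W) ≫ r = 𝟙 _ := by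
    rw [← adj.homEquiv_naturality_left, IsIso.hom_inv_id_assoc, Equiv.apply_symm_apply]
  have hs : Presheaf.IsSheaf J (sheafify J (R.obj W)) :=
    ((presheafToSheaf J _).obj (R.obj W)).property
  have : IsIso (toSheafify J (R.obj W)) :=
    ⟨r, hr, sheafify_hom_ext J _ _ hs (by rw [← Category.assoc, hr]; simp)⟩
  exact (Presheaf.isSheaf_of_iso_iff (asIso (toSheafify J (R.obj W)))).2 hs

/-- The geometric morphism `Set^G → Set[T]` classifying a model of `T` with an action of `G`. -/
noncomputable def classifyingMorphism :
    GeomMorphism (SetAct.{u} G) T.ClassifyingTopos where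
  inverse := sheafToPresheaf _ _ ⋙ presheafInverse A
  direct := ObjectProperty.lift _ (presheafInverse A).rightAdjoint
    (isSheaf_of_adjunction (Adjunction.ofIsLeftAdjoint _) (isInvertedBy_presheafInverse A))
  adj := (Adjunction.ofIsLeftAdjoint (presheafInverse A)).restrictFullyFaithful
    (fullyFaithfulSheafToPresheaf _ _) (Functor.FullyFaithful.id _) (Iso.refl _) (Iso.refl _)
  preservesFiniteLimits := inferInstance

end Point

variable {T : Theory L} {G : Type} [Monoid G]

/-! ### The model classified by the geometric morphism of a model -/

theorem toPresheafFiber_pointMap {M N : T.Model} (h : M ⟶ N) (X : SynCat T) (x : X.Interp M)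
    (P : (SynCat T)ᵒᵖ ⥤ Type u) :
    M.point.toPresheafFiber X x P ≫ ((presheafFiber T).map h).app P =
      N.point.toPresheafFiber X (X.onInterp h x) P := by
  exact M.point.toPresheafFiber_presheafFiberDesc
    (fun X x => N.point.toPresheafFiber X ((pointMap h).hom.app X x) P)
    (fun X Y f x => by
      rw [N.point.toPresheafFiber_w]
      exact congrArg (N.point.toPresheafFiber Y · P)
        (NatTrans.naturality_apply (pointMap h).hom f x).symm) X x

section Classifies

variable (A : SingleObj G ⥤ T.Model)

/-- The canonical map from the interpretation of a formula to the inverse image of the presheaf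
it represents. -/
noncomputable def interpToInverse : (A ⋙ T.interp).flip ⟶ yoneda ⋙ presheafInverse A where
  app X :=
    { app := fun k => ↾fun x => (A.obj k).point.toPresheafFiber X x (yoneda.obj X) (𝟙 X)
      naturality := fun k l g => by
        ext x
        exact (ConcreteCategory.congr_hom (toPresheafFiber_pointMap (A.map g) X x (yoneda.obj X))
          (𝟙 X)).symm }
  naturality X Y f := by
    ext k x
    refine (ConcreteCategory.congr_hom
      ((A.obj k).point.toPresheafFiber_w f x (yoneda.obj Y)) (𝟙 Y)).symm.trans ?_
    refine Eq.trans ?_ (ConcreteCategory.congr_hom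
      ((A.obj k).point.toPresheafFiber_naturality (yoneda.map f) X x) (𝟙 X)).symm
    exact congrArg ((A.obj k).point.toPresheafFiber X x (yoneda.obj Y))
      ((Category.comp_id f).trans (Category.id_comp f).symm)

theorem bijective_interpToInverse (X : SynCat T) (k : SingleObj G) :
    Function.Bijective (((interpToInverse A).app X).app k) := by
  constructor
  · -- evaluation of morphisms of the syntactic category is a left inverse
    let d : (A.obj k).point.presheafFiber.obj (yoneda.obj X) ⟶ X.Interp (A.obj k) :=
      (A.obj k).point.presheafFiberDesc (fun Z z => ↾fun f : Z ⟶ X => SynCat.Mor.fn f (A.obj k) z)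
        (fun Y Z g y => by
          ext f
          exact SynCat.Mor.fn_comp g f (A.obj k) y)
    refine Function.LeftInverse.injective (g := d) fun x => ?_
    refine (ConcreteCategory.congr_hom ((A.obj k).point.toPresheafFiber_presheafFiberDesc
      (P := yoneda.obj X) _ _ X x) (𝟙 X)).trans ?_
    exact SynCat.Mor.fn_id X (A.obj k) x
  · intro y
    obtain ⟨Z, z, f, rfl⟩ := (A.obj k).point.toPresheafFiber_jointly_surjective
      (P := yoneda.obj X) y
    refine ⟨(T.interp.obj (A.obj k)).map f z, ?_⟩
    refine (ConcreteCategory.congr_hom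
      ((A.obj k).point.toPresheafFiber_w f z (yoneda.obj X)) (𝟙 X)).symm.trans ?_
    exact congrArg ((A.obj k).point.toPresheafFiber Z z (yoneda.obj X)) (Category.comp_id f)

/-- Every model of `T` in `Set^G` is classified by a geometric morphism. -/
theorem classifies_classifyingMorphism : Classifies (classifyingMorphism A) A := by
  -- elements of `φ(A)` are germs of `𝟙`, first in the representable presheaf, then in its
  -- sheafification, which has the same fibers
  let α : (A ⋙ T.interp).flip ⟶ T.generic ⋙ (classifyingMorphism A).inverse :=
    interpToInverse A ≫ Functor.whiskerLeft yoneda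
      (Functor.whiskerRight (sheafificationAdjunction T.topology (Type u)).unit (presheafInverse A))
  have : ∀ X, IsIso (α.app X) := by
    intro X
    have h₁ : IsIso ((interpToInverse A).app X) := by
      have : ∀ k, IsIso (((interpToInverse A).app X).app k) := fun k =>
        (isIso_iff_bijective _).2 (bijective_interpToInverse A X k)
      exact NatIso.isIso_of_isIso_app _
    have h₂ : IsIso ((presheafInverse A).map (toSheafify T.topology (yoneda.obj X))) :=
      isInvertedBy_presheafInverse A _ (T.topology.W_toSheafify _)
    exact IsIso.comp_isIso' h₁ h₂
  have : IsIso α := NatIso.isIso_of_isIso_app _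
  exact ⟨(asIso α).symm⟩

end Classifies

/-! ### Extending natural transformations from the generic model -/

/-- A functor on presheaves that preserves colimits is the left Kan extension of its restriction
to the representable presheaves. -/
theorem exists_extension_along_yoneda {C : Type u} [SmallCategory C]
    (F H : (Cᵒᵖ ⥤ Type u) ⥤ SetAct.{u} G) [PreservesColimitsOfSize.{u, u} F]
    (β : yoneda ⋙ F ⟶ yoneda ⋙ H) : ∃ γ : F ⟶ H, ∀ X, γ.app (yoneda.obj X) = β.app X := by
  let ω : uliftYoneda.{u} (C := C) ≅ yoneda := uliftYonedaIsoYoneda.{u}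
  let β' : uliftYoneda.{u} ⋙ F ⟶ uliftYoneda.{u} ⋙ H :=
    Functor.whiskerRight ω.hom F ≫ β ≫ Functor.whiskerRight ω.inv H
  refine ⟨F.descOfIsLeftKanExtension (𝟙 (uliftYoneda.{u} ⋙ F)) H β', fun X => ?_⟩
  have h := F.descOfIsLeftKanExtension_fac_app (𝟙 (uliftYoneda.{u} ⋙ F)) H β' X
  have hn := (F.descOfIsLeftKanExtension (𝟙 (uliftYoneda.{u} ⋙ F)) H β').naturality
    (ω.inv.app X)
  rw [NatTrans.id_app, Category.id_comp] at h
  rw [h, NatTrans.comp_app, NatTrans.comp_app, Functor.whiskerRight_app,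
    Functor.whiskerRight_app, ← Category.assoc, ← Functor.map_comp, Iso.inv_hom_id_app,
    CategoryTheory.Functor.map_id, Category.id_comp] at hn
  exact ((cancel_mono _).1 hn).symm

/-- Natural transformations extend along a localization functor, here given by a left adjoint with
fully faithful right adjoint. -/
theorem exists_extension_along_reflector {C : Type u₁} [Category.{v₁} C] {D : Type u₂}
    [Category.{v₂} D] {E : Type*} [Category* E] {a : C ⥤ D} {i : D ⥤ C} (adj : a ⊣ i)
    [IsIso adj.counit] {F H : D ⥤ E} (γ : a ⋙ F ⟶ a ⋙ H) :
    ∃ η : F ⟶ H, ∀ P, η.app (a.obj P) = γ.app P := by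
  refine ⟨(Functor.leftUnitor _).inv ≫ Functor.whiskerRight (inv adj.counit) F ≫
    (Functor.associator _ _ _).hom ≫ Functor.whiskerLeft i γ ≫ (Functor.associator _ _ _).inv ≫
      Functor.whiskerRight adj.counit H ≫ (Functor.leftUnitor _).hom, fun P => ?_⟩
  have h₁ : inv (adj.counit.app (a.obj P)) = a.map (adj.unit.app P) :=
    IsIso.inv_eq_of_inv_hom_id (adj.left_triangle_components P)
  have h₂ := γ.naturality (adj.unit.app P)
  have h₃ := adj.left_triangle_components P
  simp only [NatTrans.comp_app, Functor.whiskerRight_app, NatIso.isIso_inv_app, h₁]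
  simp only [Functor.comp_map] at h₂
  simp [reassoc_of% h₂, ← Functor.map_comp, h₃]

/-- A natural transformation between the restrictions to the generic model of two inverse image
functors extends to all of `Set[T]`, since these functors preserve colimits and every sheaf is a
colimit of sheaves associated to representable presheaves. -/
theorem exists_extension (p q : GeomMorphism (SetAct.{u} G) T.ClassifyingTopos)
    (β : T.generic ⋙ p.inverse ⟶ T.generic ⋙ q.inverse) :
    ∃ η : p.inverse ⟶ q.inverse, ∀ X, η.app (T.generic.obj X) = β.app X := by
  have adj := sheafificationAdjunction T.topology (Type u)
  have : PreservesColimitsOfSize.{u, u} (presheafToSheaf T.topology (Type u) ⋙ p.inverse) :=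
    (adj.comp p.adj).leftAdjoint_preservesColimits
  obtain ⟨γ, hγ⟩ := exists_extension_along_yoneda
    (presheafToSheaf T.topology (Type u) ⋙ p.inverse)
    (presheafToSheaf T.topology (Type u) ⋙ q.inverse) β
  obtain ⟨η, hη⟩ := exists_extension_along_reflector adj γ
  exact ⟨η, fun X => (hη (yoneda.obj X)).trans (hγ X)⟩

/-! ### From the topos to the model -/

instance mono_generic_map {X Y : SynCat T} (f : X ⟶ Y) [Mono f] : Mono (T.generic.map f) := by
  have : Mono ((presheafToSheaf T.topology (Type u)).map (yoneda.map f)) := inferInstance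
  exact this

/-- The elements of the inverse image of the generic model are the elements of the model. -/
theorem Classifies.exists_eval {A : SingleObj G ⥤ T.Model}
    {p : GeomMorphism (SetAct.{u} G) T.ClassifyingTopos} (hp : Classifies p A) :
    ∃ ev : ∀ X : SynCat T, (p.inverse.obj (T.generic.obj X)).obj (SingleObj.star G) →
      X.Interp (A.obj (SingleObj.star G)), (∀ X, Function.Bijective (ev X)) ∧
      ∀ (X Y : SynCat T) (f : X ⟶ Y) x,
        ev Y ((p.inverse.map (T.generic.map f)).app _ x) = SynCat.Mor.fn f _ (ev X x) := by
  obtain ⟨e⟩ := hp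
  refine ⟨fun X => (e.hom.app X).app (SingleObj.star G), fun X => ?_, fun X Y f x => ?_⟩
  · exact (isIso_iff_bijective _).1 inferInstance
  · exact ConcreteCategory.congr_hom (NatTrans.congr_app (e.hom.naturality f) _) x

/-- If homomorphisms out of the model underlying `A` extend to homomorphisms out of `A`, then this
model is existentially closed as soon as the geometric morphism classifying `A` is. -/
theorem GeomMorphism.IsEC.isEC_of_classifies {A : SingleObj G ⥤ T.Model}
    {p : GeomMorphism (SetAct.{u} G) T.ClassifyingTopos} (hp : Classifies p A)
    (hA : ∀ ⦃N : T.Model⦄ (f : A.obj (SingleObj.star G) ⟶ N), ∃ (A' : SingleObj G ⥤ T.Model)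
      (h : A ⟶ A') (k : N ⟶ A'.obj (SingleObj.star G)), f ≫ k = h.app (SingleObj.star G))
    (h : p.IsEC) : (A.obj (SingleObj.star G)).IsEC := by
  intro N f Γ φ a ha
  obtain ⟨A', h', k, hk⟩ := hA f
  obtain ⟨e⟩ := hp
  obtain ⟨e'⟩ := classifies_classifyingMorphism A'
  obtain ⟨η, hη⟩ := exists_extension p (classifyingMorphism A')
    (e.hom ≫ (flipFunctor _ _ _).map (Functor.whiskerRight h' T.interp) ≫ e'.inv)
  let X : SynCat T := ⟨Γ, .top⟩
  have hb : (X.sub φ).form.Holds (Str.Hom.onTuple (h'.app (SingleObj.star G)) a) := by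
    refine ⟨trivial, ?_⟩
    rw [← hk]
    exact Str.Hom.map_holds k φ _ ha
  have inv_hom : ∀ y, (e.hom.app X).app (SingleObj.star G) ((e.inv.app X).app _ y) = y := fun y =>
    ConcreteCategory.congr_hom (NatTrans.congr_app (e.inv_hom_id_app X) _) y
  have pb := (h _ η (T.generic.map (X.subι φ))).app (SingleObj.star G)
  obtain ⟨z, hz, -⟩ := Types.exists_of_isPullback pb.flip
    ((e.inv.app X).app (SingleObj.star G) ⟨a, trivial⟩)
    ((e'.inv.app (X.sub φ)).app (SingleObj.star G) ⟨_, hb⟩) (by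
      rw [hη]
      refine (congrArg (fun y => (e'.inv.app X).app (SingleObj.star G)
        (X.onInterp (h'.app (SingleObj.star G)) y)) (inv_hom ⟨a, trivial⟩)).trans ?_
      refine Eq.trans ?_ (ConcreteCategory.congr_hom (NatTrans.congr_app
        (e'.inv.naturality (X.subι φ)) (SingleObj.star G)) ⟨_, hb⟩)
      exact congrArg ((e'.inv.app X).app (SingleObj.star G)) (SynCat.fn_subι X φ _ ⟨_, hb⟩).symm)
  have key : SynCat.Mor.fn (X.subι φ) _ ((e.hom.app (X.sub φ)).app (SingleObj.star G) z) =
      (⟨a, trivial⟩ : X.Interp _) := by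
    rw [← inv_hom ⟨a, trivial⟩, ← hz]
    exact (ConcreteCategory.congr_hom (NatTrans.congr_app (e.hom.naturality (X.subι φ)) _) z).symm
  have key' : ((e.hom.app (X.sub φ)).app (SingleObj.star G) z).1 = a :=
    congrArg Subtype.val ((SynCat.fn_subι X φ _ _).symm.trans key)
  rw [← key']
  exact ((e.hom.app (X.sub φ)).app (SingleObj.star G) z).2.2

/-! ### Subobjects of a sheaf and their sections -/

section Subsheaf

variable {C : Type u} [SmallCategory C] {J : GrothendieckTopology C} {F : Sheaf J (Type u)}

/-- The subfunctor of sections of a sheaf that belong to a subobject. -/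
noncomputable def sections (A : Subobject F) : Subfunctor F.obj := Subfunctor.range A.arrow.hom

instance mono_hom {B : Sheaf J (Type u)} (f : B ⟶ F) [Mono f] : Mono f.hom :=
  inferInstanceAs (Mono ((sheafToPresheaf J (Type u)).map f))

theorem isIso_toRange_arrow (A : Subobject F) : IsIso (Subfunctor.toRange A.arrow.hom) := by
  have := mono_hom A.arrow
  infer_instance

/-- A morphism factors through a subobject as soon as all sections in its image belong to it. -/
theorem exists_factor {B : Sheaf J (Type u)} {A : Subobject F} (g : B ⟶ F)
    (h : Subfunctor.range g.hom ≤ sections A) : ∃ k, k ≫ A.arrow = g := by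
  have := isIso_toRange_arrow A
  let k := Subfunctor.lift (G := Subfunctor.range A.arrow.hom) g.hom h
  refine ⟨⟨k ≫ inv (Subfunctor.toRange A.arrow.hom)⟩, ?_⟩
  ext : 1
  change (k ≫ inv (Subfunctor.toRange A.arrow.hom)) ≫ A.arrow.hom = g.hom
  have : inv (Subfunctor.toRange A.arrow.hom) ≫ A.arrow.hom =
      (Subfunctor.range A.arrow.hom).ι := by
    rw [IsIso.inv_comp_eq]
    rfl
  rw [Category.assoc, this]
  rfl

theorem range_comp_arrow_le {B : Sheaf J (Type u)} {A : Subobject F}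
    (k : B ⟶ (A : Sheaf J (Type u))) :
    Subfunctor.range (k ≫ A.arrow).hom ≤ sections A :=
  Subfunctor.range_comp_le k.hom A.arrow.hom

theorem le_iff_sections_le {A B : Subobject F} : A ≤ B ↔ sections A ≤ sections B := by
  constructor
  · intro h
    have := range_comp_arrow_le (Subobject.ofLE A B h)
    rwa [Subobject.ofLE_arrow] at this
  · intro h
    obtain ⟨k, hk⟩ := exists_factor A.arrow h
    exact Subobject.le_of_comm k hk

theorem sections_mk {B : Sheaf J (Type u)} (f : B ⟶ F) [Mono f] :
    sections (Subobject.mk f) = Subfunctor.range f.hom := by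
  refine le_antisymm ?_ ?_
  · have := Subfunctor.range_comp_le (Subobject.underlyingIso f).hom.hom f.hom
    rwa [← ObjectProperty.FullSubcategory.comp_hom, Subobject.underlyingIso_hom_comp_eq_mk] at this
  · have := range_comp_arrow_le (Subobject.underlyingIso f).inv
    rwa [Subobject.underlyingIso_arrow] at this

/-- Membership in a subobject of a sheaf is local. -/
theorem mem_sections_of_covering (A : Subobject F) {U : Cᵒᵖ} (s : F.obj.obj U)
    {S : Sieve U.unop} (hS : S ∈ J U.unop)
    (h : ∀ ⦃V : C⦄ (f : V ⟶ U.unop), S f → F.obj.map f.op s ∈ (sections A).obj (op V)) :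
    s ∈ (sections A).obj U := by
  have hF : Presieve.IsSheaf J F.obj := (isSheaf_iff_isSheaf_of_type _ _).1 F.property
  have := isIso_toRange_arrow A
  let i := asIso (Subfunctor.toRange A.arrow.hom)
  have hA : Presieve.IsSheaf J (sections A).toFunctor := Presieve.isSheaf_iso J i
    ((isSheaf_iff_isSheaf_of_type _ _).1 (A : Sheaf J (Type u)).property)
  exact (Subfunctor.isSheaf_iff _ hF).1 hA U s (J.superset_covering (fun V f hf => h f hf) hS)

/-- Subfunctors defined by a local condition are the sections of a subobject. -/
theorem exists_sections_eq (H : Subfunctor F.obj)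
    (hH : ∀ (U) (s : F.obj.obj U), H.sieveOfSection s ∈ J (unop U) → s ∈ H.obj U) :
    ∃ A : Subobject F, sections A = H := by
  have hF : Presieve.IsSheaf J F.obj := (isSheaf_iff_isSheaf_of_type _ _).1 F.property
  let B : Sheaf J (Type u) :=
    ⟨H.toFunctor, (isSheaf_iff_isSheaf_of_type _ _).2 ((Subfunctor.isSheaf_iff _ hF).2 hH)⟩
  let i : B ⟶ F := ⟨H.ι⟩
  have : Mono i := (sheafToPresheaf J (Type u)).mono_of_mono_map
    (inferInstanceAs (Mono H.ι))
  exact ⟨Subobject.mk i, (sections_mk i).trans (Subfunctor.range_ι H)⟩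

/-- A subobject of a sheaf is least if and only if it only has sections over objects covered by
the empty sieve. -/
theorem isBot_iff_sections {D : Subobject F} :
    IsBot D ↔ ∀ (U : Cᵒᵖ), ∀ s ∈ (sections D).obj U, ⊥ ∈ J U.unop := by
  constructor
  · intro hD U s hs
    let H : Subfunctor F.obj :=
      { obj := fun U => {_s | ⊥ ∈ J U.unop}
        map := fun {U V} i _ h => by
          have := J.pullback_stable i.unop h
          rwa [Sieve.pullback_bot] at this }
    obtain ⟨E, hE⟩ := exists_sections_eq H fun U s h =>
      J.transitive h ⊥ fun V f hf => by
        rw [Sieve.pullback_bot]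
        exact hf
    have := le_iff_sections_le.1 (hD E) U hs
    rw [hE] at this
    exact this
  · intro h E
    exact le_iff_sections_le.2 fun U s hs =>
      mem_sections_of_covering E s (h U s hs) fun _ _ hf => hf.elim

theorem exists_isPseudoCompl (A : Subobject F) : ∃ N, IsPseudoCompl A N := by
  -- the sections that do not belong to `A` on any object not covered by the empty sieve
  let H : Subfunctor F.obj :=
    { obj := fun U => {s | ∀ ⦃V : C⦄ (f : V ⟶ U.unop),
        F.obj.map f.op s ∈ (sections A).obj (op V) → ⊥ ∈ J V}
      map := fun {U V} i s h W f hf => by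
        refine h (f ≫ i.unop) ?_
        rw [op_comp, Functor.map_comp_apply]
        exact hf }
  obtain ⟨N, hN⟩ := exists_sections_eq H fun U s h V f hf => by
    refine J.transitive (J.pullback_stable f h) ⊥ fun W g hg => ?_
    rw [Sieve.pullback_bot]
    refine hg (𝟙 W) ?_
    have : F.obj.map (g ≫ f).op s ∈ (sections A).obj (op W) := by
      rw [op_comp, Functor.map_comp_apply]
      exact (sections A).map g.op hf
    rw [op_id, Functor.map_id_apply]
    exact this
  refine ⟨N, fun D hDN hDA => ?_, fun E hE => ?_⟩
  · refine isBot_iff_sections.2 fun U s hs => ?_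
    have h := le_iff_sections_le.1 hDN U hs
    rw [hN] at h
    refine h (𝟙 _) ?_
    rw [op_id, Functor.map_id_apply]
    exact le_iff_sections_le.1 hDA U hs
  · refine le_iff_sections_le.2 ?_
    rw [hN]
    intro U s hs V f hf
    obtain ⟨D, hD⟩ := exists_sections_eq (sections E ⊓ sections A) fun U s h =>
      ⟨mem_sections_of_covering E s h fun _ _ hf => hf.1,
        mem_sections_of_covering A s h fun _ _ hf => hf.2⟩
    have hbot : IsBot D := hE D (le_iff_sections_le.2 (hD.le.trans inf_le_left))
      (le_iff_sections_le.2 (hD.le.trans inf_le_right))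
    refine isBot_iff_sections.1 hbot (op V) (F.obj.map f.op s) ?_
    rw [hD]
    exact ⟨(sections E).map f.op hs, hf⟩

theorem exists_isLUB_pair (A B : Subobject F) : ∃ D, IsLUB {A, B} D := by
  have hF : Presieve.IsSheaf J F.obj := (isSheaf_iff_isSheaf_of_type _ _).1 F.property
  obtain ⟨D, hD⟩ := exists_sections_eq ((sections A ⊔ sections B).sheafify J)
    ((Subfunctor.isSheaf_iff _ hF).1 (Subfunctor.sheafify_isSheaf _ hF))
  have hle : sections A ⊔ sections B ≤ sections D := hD ▸ Subfunctor.le_sheafify J _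
  refine ⟨D, ?_, fun E hE => le_iff_sections_le.2 ?_⟩
  · rintro _ (rfl | rfl)
    · exact le_iff_sections_le.2 (le_sup_left.trans hle)
    · exact le_iff_sections_le.2 (le_sup_right.trans hle)
  · rw [hD]
    have h := sup_le (le_iff_sections_le.1 (hE (Or.inl rfl)))
      (le_iff_sections_le.1 (hE (Or.inr rfl)))
    exact fun U s hs => mem_sections_of_covering E s hs fun V f hf => h _ hf

end Subsheaf

/-! ### Definable subobjects of the generic model -/

/-- The section of `φ(G_T)` given by a morphism of the syntactic category. -/
noncomputable def genericSection {Z X : SynCat T} (g : Z ⟶ X) :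
    (T.generic.obj X).obj.obj (op Z) :=
  (toSheafify T.topology (yoneda.obj X)).app (op Z) g

theorem map_genericSection {Z W X : SynCat T} (f : W ⟶ Z) (g : Z ⟶ X) :
    (T.generic.obj X).obj.map f.op (genericSection g) = genericSection (f ≫ g) :=
  (NatTrans.naturality_apply (toSheafify T.topology (yoneda.obj X)) f.op g).symm

theorem generic_map_genericSection {Z X Y : SynCat T} (g : Z ⟶ X) (k : X ⟶ Y) :
    (T.generic.map k).hom.app _ (genericSection g) = genericSection (g ≫ k) :=
  (ConcreteCategory.congr_hom (NatTrans.congr_app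
    (toSheafify_naturality T.topology (yoneda.map k)) (op Z)) g).symm

/-- Every section of the generic model is locally given by a morphism of the syntactic category. -/
theorem exists_covering_genericSection {Z : (SynCat T)ᵒᵖ} {X : SynCat T}
    (s : (T.generic.obj X).obj.obj Z) : ∃ S ∈ T.topology Z.unop, ∀ ⦃W⦄ (f : W ⟶ Z.unop), S f →
      ∃ g : W ⟶ X, (T.generic.obj X).obj.map f.op s = genericSection g := by
  refine ⟨_, Presheaf.imageSieve_mem T.topology (toSheafify T.topology (yoneda.obj X)) s, ?_⟩
  rintro W f ⟨g, hg⟩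
  exact ⟨g, hg.symm⟩

theorem exists_of_covering {Z : SynCat T} {S : Sieve Z} (hS : S ∈ T.topology Z) (M : T.Model)
    (b : Z.Interp M) : ∃ (W : SynCat T) (f : W ⟶ Z) (c : W.Interp M),
      S f ∧ SynCat.Mor.fn f M c = b := by
  obtain ⟨l, hl, hcov⟩ := hS
  obtain ⟨g, hg, c, hc⟩ := hcov M b
  exact ⟨g.1, g.2, c, hl g hg, hc⟩

/-- The subobject of the generic model defined by a formula. -/
noncomputable def definable (X : SynCat T) (φ : Formula L X.ctx) :
    Subobject (T.generic.obj X) :=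
  Subobject.mk (T.generic.map (X.subι φ))

/-- The section given by `g` belongs to the subobject defined by `φ` if and only if `T` proves that
`φ` holds on the image of `g`. -/
theorem genericSection_mem_definable {Z X : SynCat T} (φ : Formula L X.ctx) (g : Z ⟶ X) :
    genericSection g ∈ (sections (definable X φ)).obj (op Z) ↔
      ∀ (M : T.Model) (b : Z.Interp M), φ.Holds (SynCat.Mor.fn g M b).1 := by
  rw [definable, sections_mk]
  constructor
  · rintro ⟨s, hs⟩ M b
    obtain ⟨S, hS, h⟩ := exists_covering_genericSection s
    obtain ⟨W, f, c, hf, rfl⟩ := exists_of_covering hS M b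
    obtain ⟨t, ht⟩ := h f hf
    have e : genericSection (t ≫ X.subι φ) = genericSection (f ≫ g) := by
      rw [← generic_map_genericSection, ← ht, ← map_genericSection, ← hs]
      exact NatTrans.naturality_apply (T.generic.map (X.subι φ)).hom f.op s
    obtain ⟨V, k, d, hk, rfl⟩ := exists_of_covering
      (Presheaf.equalizerSieve_mem T.topology (toSheafify T.topology (yoneda.obj X)) _ _ e) M c
    have hk' : k ≫ t ≫ X.subι φ = k ≫ f ≫ g := hk
    have := congrArg (fun j => SynCat.Mor.fn j M d) hk'
    simp only [SynCat.Mor.fn_comp, SynCat.fn_subι] at this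
    rw [← this]
    exact (SynCat.Mor.fn t M _).2.2
  · intro h
    obtain ⟨e, rfl⟩ := SynCat.exists_lift_sub φ g h
    exact ⟨genericSection e, generic_map_genericSection e _⟩

theorem bot_mem_topology {Z : SynCat T} (h : ∀ M : T.Model, Z.Interp M → False) :
    ⊥ ∈ T.topology Z :=
  ⟨[], by simp, fun M a => (h M a).elim⟩

/-- Subobjects defined by incompatible formulas are disjoint. -/
theorem definable_le_of_proves {X : SynCat T} {φ ψ : Formula L X.ctx}
    (h : T.Proves (.and φ ψ) .bot) {N : Subobject (T.generic.obj X)}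
    (hN : IsPseudoCompl (definable X φ) N) : definable X ψ ≤ N := by
  refine hN.2 fun D hψ hφ => isBot_iff_sections.2 fun U s hs => ?_
  obtain ⟨S, hS, hg⟩ := exists_covering_genericSection s
  refine T.topology.transitive hS ⊥ fun W f hf => ?_
  rw [Sieve.pullback_bot]
  obtain ⟨g, hg⟩ := hg f hf
  have hs' := (sections D).map f.op hs
  rw [Set.mem_preimage, hg] at hs'
  refine bot_mem_topology fun M b => h M (SynCat.Mor.fn g M b).1 ⟨?_, ?_⟩
  · exact (genericSection_mem_definable φ g).1 (le_iff_sections_le.1 hφ _ hs') M b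
  · exact (genericSection_mem_definable ψ g).1 (le_iff_sections_le.1 hψ _ hs') M b

/-- If a subobject has the section given by `g`, it contains the subobject defined by the image
of `g`. -/
theorem definable_image_le {W X : SynCat T} (g : W ⟶ X) {φ : Formula L X.ctx}
    (hφ : ∀ (M : T.Model) (a : M.toStr.Tuple X.ctx),
      φ.Holds a ↔ ∃ b : W.Interp M, (SynCat.Mor.fn g M b).1 = a)
    {A : Subobject (T.generic.obj X)} (hg : genericSection g ∈ (sections A).obj (op W)) :
    definable X φ ≤ A := by
  refine le_iff_sections_le.2 fun U s hs => ?_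
  obtain ⟨S, hS, h⟩ := exists_covering_genericSection s
  refine mem_sections_of_covering A s hS fun V f hf => ?_
  obtain ⟨k, hk⟩ := h f hf
  have hs' := (sections (definable X φ)).map f.op hs
  rw [Set.mem_preimage, hk, genericSection_mem_definable] at hs'
  rw [hk]
  obtain ⟨P, q, q', hq, hP⟩ := SynCat.exists_pullback g k
  have hcov : Sieve.generate (Presieve.singleton q') ∈ T.topology V := by
    refine ⟨[⟨P, q'⟩], ?_, fun M a => ?_⟩
    · simpa using ⟨_, 𝟙 _, q', ⟨⟩, Category.id_comp _⟩
    · obtain ⟨b, hb⟩ := (hφ M _).1 (hs' M a)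
      obtain ⟨c, hc⟩ := hP M b a (Subtype.ext hb)
      exact ⟨_, List.mem_singleton.2 rfl, c, hc⟩
  refine mem_sections_of_covering A _ hcov ?_
  rintro V' _ ⟨_, r, _, ⟨⟩, rfl⟩
  have := (sections A).map (r ≫ q).op hg
  rw [Set.mem_preimage, map_genericSection] at this
  rw [map_genericSection, Category.assoc, ← hq, ← Category.assoc]
  exact this

/-- The definable subobjects form a basis of subobjects. -/
theorem isLUB_definable {X : SynCat T} (A : Subobject (T.generic.obj X)) :
    IsLUB {B | B ∈ Set.range (definable X) ∧ B ≤ A} A := by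
  refine ⟨fun B hB => hB.2, fun B hB => le_iff_sections_le.2 fun U s hs => ?_⟩
  obtain ⟨S, hS, h⟩ := exists_covering_genericSection s
  refine mem_sections_of_covering B s hS fun W f hf => ?_
  obtain ⟨g, hg⟩ := h f hf
  have hs' := (sections A).map f.op hs
  rw [Set.mem_preimage, hg] at hs'
  rw [hg]
  obtain ⟨φ, hφ⟩ := SynCat.exists_image_formula g
  refine le_iff_sections_le.1 (hB ⟨⟨φ, rfl⟩, definable_image_le g hφ hs'⟩) _ ?_
  exact (genericSection_mem_definable φ g).2 fun M b => (hφ M _).2 ⟨b, rfl⟩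

/-- Morphisms `φ(G_T) ⟶ F` correspond to sections of `F` over `{x . φ}`. -/
theorem isSeparating_generic : (ObjectProperty.ofObj T.generic.obj).IsSeparating := by
  intro F F' f g h
  ext Z s
  let adj := sheafificationAdjunction T.topology (Type u)
  let k : (presheafToSheaf T.topology (Type u)).obj (yoneda.obj Z.unop) ⟶ F :=
    (adj.homEquiv _ _).symm (yonedaEquiv.symm s)
  have hk : yonedaEquiv.symm s ≫ f.hom = yonedaEquiv.symm s ≫ g.hom := by
    have h₁ := adj.homEquiv_naturality_right k f
    have h₂ := adj.homEquiv_naturality_right k g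
    rw [Equiv.apply_symm_apply] at h₁ h₂
    exact h₁.symm.trans ((congrArg (adj.homEquiv _ _) (h _ ⟨Z.unop⟩ k)).trans h₂)
  have := ConcreteCategory.congr_hom (NatTrans.congr_app hk Z) (𝟙 Z.unop)
  simpa [yonedaEquiv] using this

/-! ### From the model to the topos -/

/-- If the model underlying `A` is strongly existentially closed, then so is the geometric
morphism classifying `A`: the definable subobjects of the generic model are complemented along
it. -/
theorem Theory.Model.IsSEC.isSEC_of_classifies {A : SingleObj G ⥤ T.Model}
    {p : GeomMorphism (SetAct.{u} G) T.ClassifyingTopos} (hp : Classifies p A)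
    (h : (A.obj (SingleObj.star G)).IsSEC) : p.IsSEC := by
  obtain ⟨ev, hev, hfn⟩ := hp.exists_eval
  refine ⟨SynCat T, T.generic.obj, fun X => Set.range (definable X), isSeparating_generic,
    fun X B => ⟨_, fun _ h => h.1, isLUB_definable B⟩, ?_⟩
  rintro X _ ⟨φ, rfl⟩
  obtain ⟨N, hN⟩ := exists_isPseudoCompl (definable X φ)
  obtain ⟨D, hD⟩ := exists_isLUB_pair (definable X φ) N
  refine ⟨N, D, hN, hD, ?_⟩
  -- elements of the model satisfying a formula lie in the inverse image of any subobject
  -- containing the subobject it defines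
  have key : ∀ χ : Formula L X.ctx, Subobject.mk (T.generic.map (X.subι χ)) ≤ D →
      ∀ x, χ.Holds (ev X x).1 → ∃ z, (p.inverse.map D.arrow).app (SingleObj.star G) z = x := by
    intro χ hχ x hx
    obtain ⟨z, hz⟩ := (hev (X.sub χ)).2 ⟨(ev X x).1, (ev X x).2, hx⟩
    refine ⟨(p.inverse.map (Subobject.ofMkLE _ D hχ)).app _ z, ?_⟩
    rw [← p.map_comp_app, Subobject.ofMkLE_arrow]
    refine (hev X).1 ?_
    rw [hfn, hz]
    exact SynCat.fn_subι X χ _ _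
  have : ∀ c, IsIso ((p.inverse.map D.arrow).app c) := by
    intro c
    obtain rfl : c = SingleObj.star G := rfl
    refine (isIso_iff_bijective _).2 ⟨p.mono_app D.arrow, fun x => ?_⟩
    by_cases hx : φ.Holds (ev X x).1
    · exact key φ (hD.1 (Or.inl rfl)) x hx
    · obtain ⟨ψ, hψ, hx⟩ := h φ _ hx
      exact key ψ ((definable_le_of_proves hψ hN).trans (hD.1 (Or.inr rfl))) x hx
  exact NatIso.isIso_of_isIso_app _

/-! ### Models with an endomorphism or an automorphism -/

/-- The equivalence holds for every model of `T` in `Set^G` such that homomorphisms out of the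
underlying model extend to homomorphisms out of the model in `Set^G`. -/
theorem tfae_of_extension {A : SingleObj G ⥤ T.Model}
    {p : GeomMorphism (SetAct.{u} G) T.ClassifyingTopos} (hp : Classifies p A)
    (hA : ∀ ⦃N : T.Model⦄ (f : A.obj (SingleObj.star G) ⟶ N), ∃ (A' : SingleObj G ⥤ T.Model)
      (h : A ⟶ A') (k : N ⟶ A'.obj (SingleObj.star G)), f ≫ k = h.app (SingleObj.star G)) :
    List.TFAE [p.IsEC, p.IsSEC, (A.obj (SingleObj.star G)).IsEC,
      (A.obj (SingleObj.star G)).IsSEC] := by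
  tfae_have 1 → 3 := GeomMorphism.IsEC.isEC_of_classifies hp hA
  tfae_have 3 → 4 := fun h => h.isSEC
  tfae_have 4 → 2 := fun h => h.isSEC_of_classifies hp
  tfae_have 2 → 1 := fun h => h.isEC
  tfae_finish

/-- Under the amalgamation property, homomorphisms out of `M` extend to homomorphisms out of
`(M, σ)` in the category of models with an endomorphism. -/
theorem exists_extension_endoModel (hT : T.Amalgamation) {M N : T.Model} (σ : End M) (f : M ⟶ N) :
    ∃ (A' : SingleObj (Multiplicative ℕ) ⥤ T.Model) (h : endoModel σ ⟶ A')
      (k : N ⟶ A'.obj (SingleObj.star _)), f ≫ k = h.app (SingleObj.star _) := by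
  obtain ⟨N', k, τ, h⟩ := exists_equivariant_endomorphism hT σ f
  refine ⟨endoModel τ, SingleObj.natTrans (f ≫ k) (comp_powersHom ?_), k, rfl⟩
  exact h.trans (Category.assoc f k τ).symm

/-- Under the amalgamation property, homomorphisms out of `M` extend to homomorphisms out of
`(M, σ)` in the category of models with an automorphism. -/
theorem exists_extension_autoModel (hT : T.Amalgamation) {M N : T.Model} (σ : Aut M) (f : M ⟶ N) :
    ∃ (A' : SingleObj (Multiplicative ℤ) ⥤ T.Model) (h : autoModel σ ⟶ A')
      (k : N ⟶ A'.obj (SingleObj.star _)), f ≫ k = h.app (SingleObj.star _) := by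
  obtain ⟨N', k, τ, h⟩ := exists_equivariant_endomorphism hT σ.hom f
  obtain ⟨N'', k', ρ, h'⟩ := exists_equivariant_automorphism τ
  have e : σ.hom ≫ f ≫ k ≫ k' = (f ≫ k ≫ k') ≫ ρ.hom := by
    rw [Category.assoc, Category.assoc, ← h']
    simpa using congrArg (· ≫ k') h
  exact ⟨autoModel (M := N'') ρ, SingleObj.natTrans (f ≫ k ≫ k') (comp_zpowersHom e), k ≫ k', rfl⟩

end CohLogic

theorem mainTheorem11 {L : CohLogic.Signature.{u}} (T : CohLogic.Theory L)
    (hT : T.Amalgamation) :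
    (∀ (M : T.Model) (σ : CategoryTheory.End M),
      (∃ p : CohLogic.GeomMorphism (CohLogic.SetAct.{u} (Multiplicative ℕ)) T.ClassifyingTopos,
        CohLogic.Classifies p (CohLogic.endoModel σ)) ∧
      ∀ p : CohLogic.GeomMorphism (CohLogic.SetAct.{u} (Multiplicative ℕ)) T.ClassifyingTopos,
        CohLogic.Classifies p (CohLogic.endoModel σ) →
          List.TFAE [p.IsEC, p.IsSEC, M.IsEC, M.IsSEC]) ∧
    (∀ (M : T.Model) (σ : CategoryTheory.Aut M),
      (∃ p : CohLogic.GeomMorphism (CohLogic.SetAct.{u} (Multiplicative ℤ)) T.ClassifyingTopos,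
        CohLogic.Classifies p (CohLogic.autoModel σ)) ∧
      ∀ p : CohLogic.GeomMorphism (CohLogic.SetAct.{u} (Multiplicative ℤ)) T.ClassifyingTopos,
        CohLogic.Classifies p (CohLogic.autoModel σ) →
          List.TFAE [p.IsEC, p.IsSEC, M.IsEC, M.IsSEC]) :=
  ⟨fun _ σ => ⟨⟨_, CohLogic.classifies_classifyingMorphism _⟩, fun _ hp =>
      CohLogic.tfae_of_extension hp fun _ f => CohLogic.exists_extension_endoModel hT σ f⟩,
    fun _ σ => ⟨⟨_, CohLogic.classifies_classifyingMorphism _⟩, fun _ hp =>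
      CohLogic.tfae_of_extension hp fun _ f => CohLogic.exists_extension_autoModel hT σ f⟩⟩
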